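/- Let $p$ be a prime and let $K$ be a local field of characteristic $p$, that is, the fraction field of a complete discrete valuation ring, with algebraically closed residue field; let $v_K$ be its normalised valuation. For a finite Galois extension $E/K$ with group $G$, let $G_i=\{\sigma\in G: v_E(\sigma x-x)\ge i+1 \text{ for all integers } x \text{ of } E\}$, put $G_u=G_{\lceil u\rceil}$ for real $u\ge -1$, and $G^v=G_{\psi(v)}$, where $\psi$ is the inverse of $\varphi(v)=\int_0^v du/[G:G_u]$. The upper jumps of $E/K$ (or of $G$) are the $u\ge 0$ with $G^u\ne\bigcup_{\varepsilon>0}G^{u+\varepsilon}$. Say that $E/K$ corresponds to $(\alpha_0,\alpha_1)\in W_2(K)$ (Witt vectors of length two) through $(a_0,a_1)\in W_2(E)$ if $(a_0^p,a_1^p)-(a_0,a_1)=(\alpha_0,\alpha_1)$ in $W_2(E)$ and $E=K(a_0,a_1)$. Let $L\neq M$ be totally ramified $\mathbb{Z}/p^2\mathbb{Z}$-extensions of $K$ inside a common extension field of $K$, and suppose that $L$ and $M$ are not linearly disjoint over $K$. Then $L\cap M$ is a $\mathbb{Z}/p\mathbb{Z}$-extension of $K$ and $G=\mathrm{Gal}(LM/K)\cong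 \mathbb{Z}/p^2\mathbb{Z}\times\mathbb{Z}/p\mathbb{Z}$. Each of $L/K$ and $M/K$ has exactly two upper jumps, say $u_0<u_1$ and $v_0<v_1$ respectively, and the following hold. 1. If $L$ and $M$ correspond to $(\alpha_0,\alpha_1)$ and $(\beta_0,\beta_1)$ through $(a_0,a_1)$ and $(b_0,b_1)$ respectively, then $L\cap M=K(a_0)=K(b_0)$. Moreover $u_0=v_0$, and this is the only upper jump of $(L\cap M)/K$. 2. If $u_1\ne v_1$, then the upper jumps of $G$ are exactly $u_0,u_1,v_1$. 3. Suppose $u_1=v_1$, let $L$ and $M$ correspond to Witt vectors $(\alpha_0,\alpha_1)$ and $(\beta_0,\beta_1)$ in $W_2(K)$ (for example reduced ones), and suppose that $\alpha_0=c\beta_0$ for some nonzero $c\in\mathbb{F}_p$. If $v_K(\alpha_1-c\beta_1)$ is prime to $p$ and different from $-u_0$ and $-u_1$, then the upper jumps of $G$ are exactly $u_0$, $u_1=v_1$ and $-v_K(\alpha_1-c\beta_1)$. -/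

import Mathlib

namespace LocalRamification

/-! `R` is a discrete valuation ring, `K` its field of fractions, `E` an extension field of `K`. -/

/-- The normalised additive valuation `v_K : K → ℤ` of the fraction field `K` of a discrete
valuation ring `R` (with the value `0` at `0`). -/
noncomputable def ord (R K : Type*) [CommRing R] [IsDomain R] [IsDiscreteValuationRing R]
    [Field K] [Algebra R K] [IsFractionRing R K] (x : K) : ℤ :=
  -WithZero.log ((IsDiscreteValuationRing.maximalIdeal R).valuation K x)

/-- The maximal ideal of the ring of integers `S` of `E`, where `S` is the integral closure of `R`
in `E`. It is written as the Jacobson radical of `S`, which is the maximal ideal because `S` is a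
local ring when `R` is complete and `E/K` is finite; see `intMaxIdeal_eq`. -/
def intMaxIdeal (R E : Type*) [CommRing R] [Field E] [Algebra R E] :
    Ideal (integralClosure R E) :=
  (⊥ : Ideal (integralClosure R E)).jacobson

theorem intMaxIdeal_eq (R E : Type*) [CommRing R] [Field E] [Algebra R E]
    [IsLocalRing (integralClosure R E)] :
    intMaxIdeal R E = IsLocalRing.maximalIdeal (integralClosure R E) :=
  IsLocalRing.jacobson_eq_maximalIdeal ⊥ bot_ne_top

/-- `E/K` is totally ramified: the residue field extension is trivial, i.e. every integer of `E`
is congruent to an element of `R` modulo the maximal ideal. -/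
def IsTotallyRamified (R E : Type*) [CommRing R] [Field E] [Algebra R E] : Prop :=
  ∀ x : integralClosure R E, ∃ r : R,
    x - algebraMap R (integralClosure R E) r ∈ intMaxIdeal R E

section Filtration

variable (R K E : Type*) [CommRing R] [Field K] [Algebra R K] [Field E] [Algebra K E]
  [Algebra R E] [IsScalarTower R K E]

theorem isIntegral_map_aut (σ : Gal(E/K)) (x : integralClosure R E) :
    IsIntegral R (σ (x : E)) :=
  IsIntegral.map (σ.toAlgHom.restrictScalars R) x.2

/-- The lower ramification group
`G_i = {σ ∈ G : v_E (σ x - x) ≥ i + 1 for all x in the ring of integers}`, for `i ≥ -1`. -/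
def lowerGroup (i : ℤ) : Subgroup Gal(E/K) where
  carrier := {σ | ∀ x : integralClosure R E,
    ∃ y ∈ intMaxIdeal R E ^ (i + 1).toNat, (y : E) = σ (x : E) - x}
  one_mem' := fun x => ⟨0, Ideal.zero_mem _, by simp⟩
  mul_mem' := by
    intro σ τ hσ hτ x
    obtain ⟨y, hy, hy'⟩ := hσ ⟨τ (x : E), isIntegral_map_aut R K E τ x⟩
    obtain ⟨z, hz, hz'⟩ := hτ x
    exact ⟨y + z, Ideal.add_mem _ hy hz, by simp [hy', hz']⟩
  inv_mem' := by
    intro σ hσ x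
    obtain ⟨y, hy, hy'⟩ := hσ ⟨σ⁻¹ (x : E), isIntegral_map_aut R K E σ⁻¹ x⟩
    refine ⟨-y, neg_mem hy, ?_⟩
    simp [hy']

/-- `G_u` for real `u ≥ -1`: it is `G_m` with `m` the smallest integer `≥ u`. -/
noncomputable def lowerGroupReal (u : ℝ) : Subgroup Gal(E/K) :=
  lowerGroup R K E ⌈u⌉

/-- The Herbrand function `φ(v) = ∫_0^v du / [G : G_u]`. -/
noncomputable def herbrandPhi (v : ℝ) : ℝ :=
  ∫ u in (0 : ℝ)..v, 1 / ((lowerGroupReal R K E u).index : ℝ)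

/-- The inverse `ψ` of the Herbrand function on `[-1, ∞)`. -/
noncomputable def herbrandPsi (v : ℝ) : ℝ :=
  Function.invFunOn (herbrandPhi R K E) (Set.Ici (-1)) v

/-- The upper ramification group `G^v = G_{ψ(v)}`. -/
noncomputable def upperGroup (v : ℝ) : Subgroup Gal(E/K) :=
  lowerGroupReal R K E (herbrandPsi R K E v)

/-- The set of upper jumps: those `u ≥ 0` with `G^u ≠ G^{u+}`, where `G^{u+}` is the union of the
`G^{u+ε}` over `ε > 0`. -/
def upperJumps : Set ℝ :=
  {u | 0 ≤ u ∧ (upperGroup R K E u : Set Gal(E/K)) ≠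
    ⋃ ε ∈ Set.Ioi (0 : ℝ), (upperGroup R K E (u + ε) : Set Gal(E/K))}

end Filtration

/-- `E/K` is a Galois extension of degree `n` with cyclic Galois group (for `n ≥ 1`). -/
structure IsCyclicExtension (K E : Type*) [Field K] [Field E] [Algebra K E] (n : ℕ) : Prop where
  isGalois : IsGalois K E
  isCyclic : IsCyclic Gal(E/K)
  finrank_eq : Module.finrank K E = n

/-- `(a₀, a₁) ∈ W₂(E)` generates `E/K` and exhibits `E/K` as an extension corresponding to
`(α₀, α₁) ∈ W₂(K)`: `(a₀ ^ p, a₁ ^ p) - (a₀, a₁) = (α₀, α₁)` in the ring `W₂(E)` of Witt vectors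
of length two, and `E = K(a₀, a₁)`. -/
structure IsASWGenerator {p : ℕ} [Fact p.Prime] {K E : Type*} [Field K] [Field E] [Algebra K E]
    (α : TruncatedWittVector p 2 K) (a : TruncatedWittVector p 2 E) : Prop where
  eq : TruncatedWittVector.mk p (fun i => a.coeff i ^ p) - a =
    TruncatedWittVector.mk p (fun i => algebraMap K E (α.coeff i))
  adjoin_eq_top : IntermediateField.adjoin K {a.coeff 0, a.coeff 1} = ⊤

/-- `E/K` is an extension corresponding to the Witt vector `α ∈ W₂(K)`. -/
def CorrespondsTo {p : ℕ} [Fact p.Prime] {K : Type*} (E : Type*) [Field K] [Field E]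
    [Algebra K E] (α : TruncatedWittVector p 2 K) : Prop :=
  ∃ a : TruncatedWittVector p 2 E, IsASWGenerator α a

end LocalRamification

/-! Upper numbering passes to quotients (Herbrand): every upper jump of a Galois subextension is an
upper jump of the whole extension (`upperJumps_subset`). An extension of degree `p ^ n` has at most
`n` upper jumps, because the lower ramification groups at distinct jumps are nontrivial `p`-groups
of distinct orders (`ncard_upperJumps_le`). Since `LM/K` has degree `p ^ 3`, three distinct jumps
coming from subextensions are all the jumps.

Two of them come from `L`. If `u₁ ≠ v₁`, the third is `v₁`, from `M`. In part 3 it comes from an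
Artin–Schreier subextension: if `α₀ = c β₀` with `c ∈ 𝔽_p`, then `a - [c] b` has its first
coordinate `e` in `𝔽_p`, and `a - [c] b - [e] = (0, y)` with `y ^ p - y = α₁ - c β₁`. Here `y ∉ K`,
for otherwise `L ⊆ M` (`exists_artinSchreier_mem_sup`). An Artin–Schreier extension whose parameter
has negative valuation prime to `p` jumps exactly at minus that valuation
(`upperJumps_artinSchreier`).

In a cyclic extension of degree `p ^ 2`, elements of equal order have equal ramification number, and
the number grows strictly from a generator `g` to `g ^ p`. So there are two jumps, the smaller being
the jump of the subextension of degree `p` (`exists_upperJumps_eq_pair`). Applied to `L ∩ M` inside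
`L` and inside `M`, this gives `u₀ = v₀`.

Herbrand's theorem is Serre's averaging formula (`card_mul_lowerNumber_eq_sum`) followed by a purely
group-theoretic computation (`groupPhi_quotient`); the upper jumps are the values of `φ` at the
ramification numbers (`upperJumps_eq`). All of this rests on the integers of `E` being a discrete
valuation ring generated over `R` by a uniformizer, which uses completeness and the algebraically
closed residue field. -/

namespace LocalRamification

open Polynomial IsLocalRing

/-! ### Complete and Henselian rings: a criterion for being local. -/

section Complete

variable {R : Type*} [CommRing R]

/-- A finite free algebra over a ring complete along a principal ideal is complete along the
extended ideal. -/
theorem isAdicComplete_map_span_of_free (ϖ : R) [IsAdicComplete (Ideal.span {ϖ}) R]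
    (S : Type*) [CommRing S] [Algebra R S] [Module.Finite R S] [Module.Free R S] :
    IsAdicComplete (Ideal.span {algebraMap R S ϖ}) S := by
  let b := Module.Free.chooseBasis R S
  have key : ∀ (x y : S) (n : ℕ),
      x ≡ y [SMOD ((Ideal.span {algebraMap R S ϖ}) ^ n • ⊤ : Submodule S S)] ↔
      ∀ i, b.repr x i ≡ b.repr y i [SMOD ((Ideal.span {ϖ}) ^ n • ⊤ : Submodule R R)] := by
    intro x y n
    simp only [SModEq.sub_mem, smul_eq_mul, Ideal.mul_top, Ideal.span_singleton_pow,
      Ideal.mem_span_singleton]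
    constructor
    · rintro ⟨z, hz⟩ i
      refine ⟨b.repr z i, ?_⟩
      have : x - y = (ϖ ^ n) • z := by rw [hz, Algebra.smul_def, map_pow]
      have h2 := congrArg (fun w => b.repr w i) this
      simpa using h2
    · intro h
      choose c hc using h
      refine ⟨∑ i, c i • b i, ?_⟩
      rw [← map_pow, ← Algebra.smul_def, Finset.smul_sum, ← b.sum_repr (x - y)]
      refine Finset.sum_congr rfl fun i _ => ?_
      rw [smul_smul, ← hc]; simp
  refine { haus' := ?_, prec' := ?_ }
  · intro x hx
    refine b.repr.map_eq_zero_iff.1 (Finsupp.ext fun i => ?_)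
    refine IsHausdorff.haus (I := Ideal.span {ϖ}) inferInstance _ fun n => ?_
    simpa using (key x 0 n).1 (hx n) i
  · intro f hf
    have h := fun i => IsPrecomplete.prec (I := Ideal.span {ϖ}) inferInstance
      (f := fun n => b.repr (f n) i) fun {m n} hmn => (key _ _ _).1 (hf hmn) i
    choose l hl using h
    refine ⟨∑ i, l i • b i, fun n => (key _ _ _).2 fun i => ?_⟩
    have : b.repr (∑ j, l j • b j) i = l i := by
      rw [b.repr_sum_self]
    rw [this]
    exact hl i n

/-- A domain `S` that is Henselian along an ideal `I` with `S ⧸ I` Artinian is local. -/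
theorem isLocalRing_of_henselianRing {S : Type*} [CommRing S] [IsDomain S] (I : Ideal S)
    (hI : I ≠ ⊤) [HenselianRing S I] [IsArtinianRing (S ⧸ I)] : IsLocalRing S := by
  have : Nontrivial (S ⧸ I) := Ideal.Quotient.nontrivial_iff.2 hI
  -- Idempotents lift by Hensel: at an idempotent the derivative `2a - 1` of `X ^ 2 - X` has square
  -- `1` modulo `I`. In the domain `S` the lift is `0` or `1`.
  have hid : ∀ x : S ⧸ I, x * x = x → x = 0 ∨ x = 1 := by
    intro x hx
    obtain ⟨a, rfl⟩ := Ideal.Quotient.mk_surjective x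
    obtain ⟨c, hc, hca⟩ := HenselianRing.is_henselian (I := I) (X ^ 2 - X : S[X])
      (by monicity!) a
      (by rw [← Ideal.Quotient.eq_zero_iff_mem]; simp [pow_two, hx])
      (by
        refine .of_mul_eq_one (Ideal.Quotient.mk I (2 * a - 1)) ?_
        have : ((2 : S ⧸ I) * Ideal.Quotient.mk I a - 1) * (2 * Ideal.Quotient.mk I a - 1) = 1 := by
          linear_combination 4 * hx
        simpa [derivative_pow, map_ofNat] using this)
    have hc' : c * (c - 1) = 0 := by
      have : c ^ 2 - c = 0 := by simpa [IsRoot] using hc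
      linear_combination this
    rw [← Ideal.Quotient.eq.2 hca]
    rcases mul_eq_zero.1 hc' with h | h
    · left; simp [h]
    · right; simp [sub_eq_zero.1 h]
  have hloc : IsLocalRing (S ⧸ I) := by
    refine IsLocalRing.of_isUnit_or_isUnit_one_sub_self fun a => ?_
    -- The descending chain of the ideals `(a ^ n)` stops. Then `a ^ n * y ^ n` is idempotent: if it
    -- is `0`, `a` is nilpotent; if it is `1`, `a` is a unit.
    obtain ⟨n, hn⟩ : ∃ n : ℕ, ∃ y : S ⧸ I, a ^ n = a ^ (n + 1) * y := by
      obtain ⟨n, y, h⟩ := IsArtinian.exists_pow_succ_smul_dvd a (1 : S ⧸ I)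
      refine ⟨n, y, ?_⟩
      simpa using h.symm
    obtain ⟨y, hy⟩ := hn
    have hpow : ∀ k, a ^ n = a ^ (n + k) * y ^ k := by
      intro k
      induction k with
      | zero => simp
      | succ k ih =>
        calc a ^ n = a ^ (n + k) * y ^ k := ih
          _ = a ^ n * a ^ k * y ^ k := by ring
          _ = a ^ (n + 1) * y * a ^ k * y ^ k := by rw [← hy]
          _ = _ := by ring
    have h2 := hpow n
    rcases hid (a ^ n * y ^ n) (by
      calc a ^ n * y ^ n * (a ^ n * y ^ n) = (a ^ (n + n) * y ^ n) * y ^ n := by ring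
        _ = _ := by rw [← h2]) with h | h
    · right
      have h0 : a ^ n = 0 := by
        rw [h2, pow_add, mul_assoc, h, mul_zero]
      exact (IsNilpotent.isUnit_one_sub ⟨n, h0⟩)
    · rcases Nat.eq_zero_or_pos n with rfl | hn
      · left
        refine .of_mul_eq_one y ?_
        simpa using hy.symm
      · left
        exact isUnit_of_dvd_one ((dvd_pow_self a hn.ne').trans ⟨_, h.symm⟩)
  have := isLocalHom_of_le_jacobson_bot I (HenselianRing.jac (I := I))
  exact (Ideal.Quotient.mk I).domain_isLocalRing

end Complete

/-! ### The ring of integers of a finite separable extension. -/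

section IntegralClosure

variable (R K E : Type*) [CommRing R] [IsDomain R] [IsDiscreteValuationRing R]
  [Field K] [Algebra R K] [IsFractionRing R K] [Field E] [Algebra K E] [FiniteDimensional K E]
  [Algebra.IsSeparable K E] [Algebra R E] [IsScalarTower R K E]

omit [IsDomain R] [IsDiscreteValuationRing R] [FiniteDimensional K E]
  [Algebra.IsSeparable K E] in
include K in
theorem faithfulSMul_extension : FaithfulSMul R E := by
  rw [faithfulSMul_iff_algebraMap_injective, IsScalarTower.algebraMap_eq R K E]
  exact (algebraMap K E).injective.comp (IsFractionRing.injective R K)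

include K

theorem finite_integralClosure : Module.Finite R (integralClosure R E) :=
  IsIntegralClosure.finite R K E _

theorem free_integralClosure : Module.Free R (integralClosure R E) := by
  have := faithfulSMul_extension R K E
  exact IsIntegralClosure.module_free R K E _

omit [IsDiscreteValuationRing R] [Algebra.IsSeparable K E] in
theorem isFractionRing_integralClosure : IsFractionRing (integralClosure R E) E :=
  integralClosure.isFractionRing_of_finite_extension K E

/-- The integral closure is finite free over `R`, hence complete and so Henselian along `(ϖ)`;
modulo `ϖ` it is a finite algebra over the residue field, hence Artinian. -/
theorem isLocalRing_integralClosure [IsAdicComplete (maximalIdeal R) R] :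
    IsLocalRing (integralClosure R E) := by
  have := finite_integralClosure R K E
  have := free_integralClosure R K E
  have := faithfulSMul_extension R K E
  obtain ⟨ϖ, hϖ⟩ := IsDiscreteValuationRing.exists_irreducible R
  have hm : maximalIdeal R = Ideal.span {ϖ} := hϖ.maximalIdeal_eq
  have : IsAdicComplete (Ideal.span {ϖ}) R := hm ▸ inferInstance
  have : (Ideal.span {ϖ}).IsMaximal := hm ▸ inferInstance
  have := isAdicComplete_map_span_of_free ϖ (integralClosure R E)
  let := Ideal.Quotient.field (Ideal.span {ϖ})
  have : IsArtinianRing (integralClosure R E ⧸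
      Ideal.span {algebraMap R (integralClosure R E) ϖ}) := by
    have h : IsArtinianRing (integralClosure R E ⧸
        (Ideal.span {ϖ}).map (algebraMap R (integralClosure R E))) :=
      IsArtinianRing.of_finite (R ⧸ Ideal.span {ϖ}) _
    rwa [Ideal.map_span, Set.image_singleton] at h
  refine isLocalRing_of_henselianRing (Ideal.span {algebraMap R (integralClosure R E) ϖ}) ?_
  rw [Ne, Ideal.span_singleton_eq_top]
  intro hu
  exact hϖ.not_isUnit ((isUnit_map_iff (algebraMap R (integralClosure R E)) ϖ).1 hu)

theorem isDiscreteValuationRing_integralClosure [IsAdicComplete (maximalIdeal R) R] :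
    IsDiscreteValuationRing (integralClosure R E) := by
  have := isLocalRing_integralClosure R K E
  have := faithfulSMul_extension R K E
  have hD : IsDedekindDomain (integralClosure R E) := integralClosure.isDedekindDomain R K E
  have hf : ¬ IsField (integralClosure R E) := by
    intro h
    exact IsDiscreteValuationRing.not_isField R
      (isField_of_isIntegral_of_isField (FaithfulSMul.algebraMap_injective R _) h)
  exact ((IsDiscreteValuationRing.TFAE _ hf).out 0 2).2 hD

end IntegralClosure

end LocalRamification

namespace LocalRamification

open Polynomial IsLocalRing
open IsDiscreteValuationRing (addVal addVal_le_iff_dvd addVal_eq_top_iff addVal_mul addVal_pow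
  addVal_uniformizer addVal_eq_zero_iff addVal_add)

/-! ### Depth of automorphisms of a discrete valuation ring. -/

section DVR

variable {R S : Type*} [CommRing R] [CommRing S] [IsDomain S] [IsDiscreteValuationRing S]
  [Algebra R S]

theorem mem_maximalIdeal_pow_iff_le_addVal (x : S) (n : ℕ) :
    x ∈ maximalIdeal S ^ n ↔ (n : ℕ∞) ≤ addVal S x := by
  obtain ⟨ϖ, hϖ⟩ := IsDiscreteValuationRing.exists_irreducible S
  rw [hϖ.maximalIdeal_eq, Ideal.span_singleton_pow, Ideal.mem_span_singleton,
    ← addVal_le_iff_dvd, hϖ.addVal_pow]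

theorem addVal_sub_le (x y : S) : min (addVal S x) (addVal S y) ≤ addVal S (x - y) := by
  have h := addVal_add (a := x) (b := -y)
  rwa [(addVal S).map_neg, ← sub_eq_add_neg] at h

theorem addVal_ringEquiv {S' : Type*} [CommRing S'] [IsDomain S'] [IsDiscreteValuationRing S']
    (σ : S ≃+* S') (x : S) : addVal S' (σ x) = addVal S x := by
  rcases eq_or_ne x 0 with rfl | hx
  · simp
  obtain ⟨ϖ, hϖ⟩ := IsDiscreteValuationRing.exists_irreducible S
  obtain ⟨n, u, rfl⟩ := IsDiscreteValuationRing.eq_unit_mul_pow_irreducible hx hϖ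
  have h : Irreducible (σ ϖ) := (MulEquiv.irreducible_iff σ.toMulEquiv).2 hϖ
  rw [IsDiscreteValuationRing.addVal_def' u hϖ]
  exact IsDiscreteValuationRing.addVal_def _ (Units.map σ.toMonoidHom u) h n (by simp)

/-- As residues come from `R`, every element can be expanded in powers of `ϖ` with coefficients in
`R` to any finite order. Order `e`, the valuation in `S` of a uniformizer `t` of `R`, suffices: then
`R[ϖ] + tS = S`, and Nakayama concludes. -/
theorem adjoin_uniformizer_eq_top [IsDomain R] [IsDiscreteValuationRing R] [Module.Finite R S]
    [FaithfulSMul R S]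
    (hres : ∀ x : S, ∃ r : R, x - algebraMap R S r ∈ maximalIdeal S)
    {ϖ : S} (hϖ : Irreducible ϖ) : Algebra.adjoin R {ϖ} = ⊤ := by
  have approx : ∀ (n : ℕ) (x : S), ∃ y ∈ Algebra.adjoin R {ϖ}, ϖ ^ n ∣ x - y := by
    intro n
    induction n with
    | zero => exact fun x => ⟨0, zero_mem _, by simp⟩
    | succ n ih =>
      intro x
      obtain ⟨y, hy, z, hz⟩ := ih x
      obtain ⟨r, hr⟩ := hres z
      rw [hϖ.maximalIdeal_eq, Ideal.mem_span_singleton] at hr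
      obtain ⟨w, hw⟩ := hr
      refine ⟨y + ϖ ^ n * algebraMap R S r, ?_, w, ?_⟩
      · exact add_mem hy (mul_mem (pow_mem (Algebra.self_mem_adjoin_singleton R ϖ) n)
          (Subalgebra.algebraMap_mem _ r))
      · linear_combination hz + ϖ ^ n * hw
  obtain ⟨t, ht⟩ := IsDiscreteValuationRing.exists_irreducible R
  have ht0 : algebraMap R S t ≠ 0 := by
    simpa using ht.ne_zero
  obtain ⟨e, u, hu⟩ := IsDiscreteValuationRing.eq_unit_mul_pow_irreducible ht0 hϖ
  have h : (⊤ : Submodule R S) ≤ Subalgebra.toSubmodule (Algebra.adjoin R {ϖ}) := by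
    refine Submodule.le_of_le_smul_of_le_jacobson_bot (I := maximalIdeal R)
      Module.Finite.fg_top (maximalIdeal_le_jacobson ⊥) ?_
    intro x _
    obtain ⟨y, hy, z, hz⟩ := approx e x
    have : x = y + t • ((↑u⁻¹ : S) * z) := by
      rw [Algebra.smul_def, hu]
      linear_combination hz - (ϖ ^ e * z) * u.mul_inv
    rw [this]
    exact Submodule.add_mem_sup hy (Submodule.smul_mem_smul ((mem_maximalIdeal _).2 ht.not_isUnit)
      trivial)
  exact eq_top_iff.2 fun x hx => h trivial

/-- The depth `⨅ x, v (σ x - x)` of an automorphism of a discrete valuation ring. -/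
noncomputable def autDepth (σ : S ≃ₐ[R] S) : ℕ∞ := ⨅ x, addVal S (σ x - x)

theorem autDepth_le (σ : S ≃ₐ[R] S) (x : S) : autDepth σ ≤ addVal S (σ x - x) := iInf_le _ x

/-- For every polynomial `g` over `R`, `σ ϖ - ϖ` divides `g(σ ϖ) - g(ϖ)`, so a generator realises
the infimum. -/
theorem autDepth_eq_of_adjoin {ϖ : S} (h : Algebra.adjoin R {ϖ} = ⊤) (σ : S ≃ₐ[R] S) :
    autDepth σ = addVal S (σ ϖ - ϖ) := by
  refine le_antisymm (iInf_le _ ϖ) (le_iInf fun x => ?_)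
  have hx : x ∈ Algebra.adjoin R {ϖ} := h ▸ Algebra.mem_top
  obtain ⟨g, rfl⟩ := Algebra.adjoin_singleton_eq_range_aeval R ϖ ▸ hx
  rw [addVal_le_iff_dvd]
  change _ ∣ σ (aeval ϖ g) - aeval ϖ g
  have h2 : σ (aeval ϖ g) = aeval (σ ϖ) g := (aeval_algHom_apply σ ϖ g).symm
  rw [h2, aeval_def, aeval_def, ← eval_map, ← eval_map]
  exact sub_dvd_eval_sub _ _ _

@[simp] theorem autDepth_eq_top_iff (σ : S ≃ₐ[R] S) : autDepth σ = ⊤ ↔ σ = 1 := by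
  simp only [autDepth, iInf_eq_top, AlgEquiv.ext_iff, addVal_eq_top_iff, sub_eq_zero,
    AlgEquiv.one_apply]

theorem min_autDepth_le_autDepth_mul (σ τ : S ≃ₐ[R] S) :
    min (autDepth σ) (autDepth τ) ≤ autDepth (σ * τ) := by
  refine le_iInf fun x => ?_
  have h : (σ * τ) x - x = (σ (τ x) - τ x) + (τ x - x) := by simp
  rw [h]
  exact (min_le_min (autDepth_le σ _) (autDepth_le τ _)).trans addVal_add

theorem autDepth_inv (σ : S ≃ₐ[R] S) : autDepth σ⁻¹ = autDepth σ := by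
  have key : ∀ σ : S ≃ₐ[R] S, autDepth σ ≤ autDepth σ⁻¹ := fun σ => by
    refine le_iInf fun x => (autDepth_le σ (σ⁻¹ x)).trans_eq ?_
    rw [← (addVal S).map_neg]
    have : σ (σ⁻¹ x) = x := σ.apply_symm_apply x
    rw [this, neg_sub]
  exact le_antisymm (by simpa using key σ⁻¹) (key σ)

theorem autDepth_pow_le (σ : S ≃ₐ[R] S) (n : ℕ) : autDepth σ ≤ autDepth (σ ^ n) := by
  induction n with
  | zero => simp [(autDepth_eq_top_iff (1 : S ≃ₐ[R] S)).2 rfl]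
  | succ n ih =>
    rw [pow_succ]
    exact (le_min ih le_rfl).trans (min_autDepth_le_autDepth_mul _ _)

/-- Over a trivial residue extension, `R`-automorphisms act trivially on the residue field. -/
theorem one_le_autDepth (hres : ∀ x : S, ∃ r : R, x - algebraMap R S r ∈ maximalIdeal S)
    (σ : S ≃ₐ[R] S) : 1 ≤ autDepth σ := by
  refine le_iInf fun x => ?_
  obtain ⟨r, hr⟩ := hres x
  have h : ∀ y : S, y ∈ maximalIdeal S ↔ 1 ≤ addVal S y := fun y => by
    simpa using mem_maximalIdeal_pow_iff_le_addVal y 1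
  have h1 := (h _).1 hr
  have h2 : 1 ≤ addVal S (σ (x - algebraMap R S r)) := by
    have := addVal_ringEquiv σ.toRingEquiv (x - algebraMap R S r)
    exact h1.trans_eq this.symm
  have h3 : σ x - x = σ (x - algebraMap R S r) - (x - algebraMap R S r) := by simp
  rw [h3]
  exact (le_min h2 h1).trans (addVal_sub_le _ _)

/-- An automorphism of `p`-power order is wildly ramified. -/
theorem two_le_autDepth {p : ℕ} [Fact p.Prime] [CharP S p] [IsDomain R]
    [IsDiscreteValuationRing R] [Module.Finite R S] [FaithfulSMul R S]
    (hres : ∀ x : S, ∃ r : R, x - algebraMap R S r ∈ maximalIdeal S)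
    (σ : S ≃ₐ[R] S) {k : ℕ} (hσ : σ ^ p ^ k = 1) : 2 ≤ autDepth σ := by
  obtain ⟨ϖ, hϖ⟩ := IsDiscreteValuationRing.exists_irreducible S
  rw [autDepth_eq_of_adjoin (adjoin_uniformizer_eq_top hres hϖ)]
  have hd : ϖ ∣ σ ϖ - ϖ := by
    rw [← addVal_le_iff_dvd, addVal_uniformizer hϖ]
    exact (one_le_autDepth hres σ).trans (autDepth_le _ _)
  obtain ⟨w, hw⟩ := hd
  -- Since `σ` is trivial modulo `ϖ`, iterating multiplies `ϖ` by `1 + w` each time, modulo `ϖ ^ 2`.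
  -- For `n = p ^ k` the factor is `1 + w ^ (p ^ k)`, so `σ ^ n = 1` forces `ϖ ∣ w`.
  have key : ∀ n : ℕ, ϖ ^ 2 ∣ (σ ^ n) ϖ - ϖ * (1 + w) ^ n := by
    intro n
    induction n with
    | zero => simp
    | succ n ih =>
      obtain ⟨z, hz⟩ := ih
      have h1 : ϖ ∣ σ ((1 + w) ^ n) - (1 + w) ^ n := by
        rw [← addVal_le_iff_dvd, addVal_uniformizer hϖ]
        exact (one_le_autDepth hres σ).trans (autDepth_le _ _)
      obtain ⟨y, hy⟩ := h1
      have h2 : (σ ^ (n + 1)) ϖ = σ ((σ ^ n) ϖ) := by rw [pow_succ']; rfl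
      have h3 : (σ ^ n) ϖ = ϖ * (1 + w) ^ n + ϖ ^ 2 * z := by linear_combination hz
      have h4 : σ ϖ = ϖ * (1 + w) := by linear_combination hw
      have h5 : σ ((1 + w) ^ n) = (1 + w) ^ n + ϖ * y := by linear_combination hy
      refine ⟨(1 + w) * y + (1 + w) ^ 2 * σ z, ?_⟩
      rw [h2, h3, map_add, map_mul, map_mul, map_pow σ ϖ, h4, h5]
      ring
  obtain ⟨z, hz⟩ := key (p ^ k)
  rw [hσ, add_pow_char_pow, one_pow] at hz
  have h6 : ϖ ∣ w ^ p ^ k := by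
    refine ⟨-z, mul_left_cancel₀ hϖ.ne_zero ?_⟩
    simp only [AlgEquiv.one_apply] at hz
    linear_combination -hz
  obtain ⟨y, rfl⟩ := hϖ.prime.dvd_of_dvd_pow h6
  have h7 : addVal S (ϖ ^ 2) = 2 := by rw [hϖ.addVal_pow]; rfl
  rw [← h7, addVal_le_iff_dvd]
  exact ⟨y, by rw [hw]; ring⟩

/-- Write `z = u ϖ ^ m` and let `d` be the depth. Moving `u` contributes valuation at least `m + d`,
moving `ϖ ^ m` at least `m - 1 + d`. The `+ 1` on the right avoids subtraction in `ℕ∞`. -/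
theorem addVal_add_autDepth_le {ϖ : S} (hϖ : Irreducible ϖ) (σ : S ≃ₐ[R] S)
    (h1 : 1 ≤ autDepth σ) (z : S) :
    addVal S z + autDepth σ ≤ addVal S (σ z - z) + 1 := by
  rcases eq_or_ne z 0 with rfl | hz
  · simp
  obtain ⟨m, u, rfl⟩ := IsDiscreteValuationRing.eq_unit_mul_pow_irreducible hz hϖ
  rcases eq_or_ne (autDepth σ) ⊤ with htop | htop
  · have : σ = 1 := (autDepth_eq_top_iff σ).1 htop
    simp [this]
  obtain ⟨d, hd⟩ := ENat.ne_top_iff_exists.1 htop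
  rw [← hd] at h1 ⊢
  have h1' : 1 ≤ d := by exact_mod_cast h1
  have hdvd : ∀ x, ϖ ^ d ∣ σ x - x := fun x => by
    rw [← addVal_le_iff_dvd, hϖ.addVal_pow, hd]; exact autDepth_le _ _
  have hϖσ : ϖ ∣ σ ϖ := by
    have := (dvd_pow_self ϖ (by omega : d ≠ 0)).trans (hdvd ϖ)
    exact (dvd_sub_left (dvd_refl ϖ)).1 this
  rw [IsDiscreteValuationRing.addVal_def' u hϖ]
  obtain ⟨e, rfl⟩ : ∃ e, d = e + 1 := ⟨d - 1, by omega⟩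
  have hgoal : ϖ ^ (m + e) ∣ σ (u * ϖ ^ m) - u * ϖ ^ m := by
    have e1 : σ (u * ϖ ^ m) - u * ϖ ^ m =
        (σ u - u) * σ ϖ ^ m + u * (σ ϖ ^ m - ϖ ^ m) := by
      rw [map_mul, map_pow]; ring
    rw [e1]
    refine dvd_add ?_ (Dvd.dvd.mul_left ?_ _)
    · rw [add_comm, pow_add]
      exact mul_dvd_mul ((pow_dvd_pow ϖ (by omega)).trans (hdvd u)) (pow_dvd_pow_of_dvd hϖσ m)
    · rcases Nat.eq_zero_or_pos m with rfl | hm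
      · simp
      obtain ⟨n, rfl⟩ : ∃ n, m = n + 1 := ⟨m - 1, by omega⟩
      rw [← Commute.geom_sum₂_mul (Commute.all _ _), show n + 1 + e = n + (e + 1) by ring, pow_add]
      refine mul_dvd_mul (Finset.dvd_sum fun i hi => ?_) (hdvd ϖ)
      have : i ≤ n := by simpa [Nat.lt_succ_iff] using hi
      calc ϖ ^ n = ϖ ^ i * ϖ ^ (n + 1 - 1 - i) := by rw [← pow_add]; congr 1; omega
        _ ∣ _ := mul_dvd_mul (pow_dvd_pow_of_dvd hϖσ i) dvd_rfl
  rw [← addVal_le_iff_dvd, hϖ.addVal_pow] at hgoal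
  calc ((m : ℕ∞) + ((e + 1 : ℕ) : ℕ∞)) = ((m + e : ℕ) : ℕ∞) + 1 := by push_cast; ring
    _ ≤ _ := by gcongr

/-- If `v z` is prime to the residue characteristic then `v (σ z - z)` is as small as possible. -/
theorem addVal_sub_add_one_eq {p : ℕ} [Fact p.Prime] [CharP S p] (σ : S ≃ₐ[R] S)
    {ϖ : S} (hϖ : Irreducible ϖ) (hgen : Algebra.adjoin R {ϖ} = ⊤)
    (h2 : 2 ≤ autDepth σ) {z : S} {m : ℕ} (hz : addVal S z = m) (hm : ¬ p ∣ m) :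
    addVal S (σ z - z) + 1 = m + autDepth σ := by
  have hz0 : z ≠ 0 := by
    rintro rfl
    simp at hz
  obtain ⟨m', u, rfl⟩ := IsDiscreteValuationRing.eq_unit_mul_pow_irreducible hz0 hϖ
  rw [IsDiscreteValuationRing.addVal_def' u hϖ] at hz
  obtain rfl : m' = m := by exact_mod_cast hz
  rcases eq_or_ne (autDepth σ) ⊤ with htop | htop
  · have : σ = 1 := (autDepth_eq_top_iff σ).1 htop
    rw [htop]; simp [this]
  obtain ⟨d, hd⟩ := ENat.ne_top_iff_exists.1 htop
  refine le_antisymm ?_ ?_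
  swap
  · have := addVal_add_autDepth_le hϖ σ (le_trans (by norm_num) h2) (u * ϖ ^ m')
    rwa [IsDiscreteValuationRing.addVal_def' u hϖ] at this
  rw [← hd] at h2 ⊢
  have h2' : 2 ≤ d := by exact_mod_cast h2
  have hdvd : ∀ x, ϖ ^ d ∣ σ x - x := fun x => by
    rw [← addVal_le_iff_dvd, hϖ.addVal_pow, hd]; exact autDepth_le _ _
  have hvϖ : addVal S (σ ϖ - ϖ) = d := by rw [hd, autDepth_eq_of_adjoin hgen]
  have hne : σ ϖ - ϖ ≠ 0 := by
    intro h; rw [h] at hvϖ; simp at hvϖ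
  obtain ⟨d', v, hv⟩ := IsDiscreteValuationRing.eq_unit_mul_pow_irreducible hne hϖ
  have : d' = d := by
    rw [hv, IsDiscreteValuationRing.addVal_def' v hϖ] at hvϖ; exact_mod_cast hvϖ
  subst this
  have hm0 : m' ≠ 0 := by rintro rfl; simp at hm
  obtain ⟨n, rfl⟩ : ∃ n, m' = n + 1 := ⟨m' - 1, by omega⟩
  obtain ⟨e, rfl⟩ : ∃ e, d' = e + 2 := ⟨d' - 2, by omega⟩
  obtain ⟨w, hw⟩ := hdvd u
  have hσϖ : σ ϖ = ϖ * (1 + v * ϖ ^ (e + 1)) := by linear_combination hv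
  obtain ⟨q, hq⟩ := powAddExpansion (1 : S) (v * ϖ ^ (e + 1)) (n + 1)
  have hσu : σ u = u + ϖ ^ (e + 2) * w := by linear_combination hw
  -- The leading coefficient `u v (n + 1)` is a unit because `p ∤ n + 1`. The quadratic term gains a
  -- factor `ϖ` because the depth `e + 2` is at least `2`.
  have hexp : σ (u * ϖ ^ (n + 1)) - u * ϖ ^ (n + 1) = ϖ ^ (n + e + 2) *
      (u * v * ((n + 1 : ℕ) : S) +
        ϖ * (w * (1 + v * ϖ ^ (e + 1)) ^ (n + 1) + u * q * v ^ 2 * ϖ ^ e)) := by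
    rw [map_mul, map_pow, hσu, hσϖ, mul_pow]
    simp only [one_pow, mul_one] at hq
    linear_combination (u * ϖ ^ (n + 1)) * hq
  have hunit : IsUnit (((n + 1 : ℕ) : S)) := (CharP.isUnit_natCast_iff Fact.out).2 hm
  by_contra! hcon
  have hle : ((n + e + 3 : ℕ) : ℕ∞) ≤ addVal S (σ (u * ϖ ^ (n + 1)) - u * ϖ ^ (n + 1)) := by
    have : (((n + e + 3 : ℕ) : ℕ∞)) + 1 ≤ addVal S (σ (u * ϖ ^ (n + 1)) - u * ϖ ^ (n + 1)) + 1 := by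
      refine le_trans (le_of_eq ?_) (Order.add_one_le_of_lt hcon)
      push_cast; ring
    exact (ENat.add_le_add_iff_right ENat.one_ne_top).1 this
  rw [← hϖ.addVal_pow, addVal_le_iff_dvd, hexp, pow_succ (n := n + e + 2)] at hle
  have h3 := (mul_dvd_mul_iff_left (pow_ne_zero _ hϖ.ne_zero)).1 hle
  have h4 := (dvd_add_left (dvd_mul_right ϖ _)).1 h3
  exact hϖ.not_isUnit (isUnit_of_dvd_unit h4 ((u.isUnit.mul v.isUnit).mul hunit))

/-- Put `δ = σ ϖ - ϖ`, of valuation `d ≥ 2`. Then `σ δ - δ` has valuation at least `2d - 1 ≥ d + 1`,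
so `σ ^ n ϖ - ϖ ≡ n δ` modulo `ϖ ^ (d + 1)`, and `n = p` kills the main term. -/
theorem autDepth_lt_autDepth_pow {p : ℕ} [CharP S p] (σ : S ≃ₐ[R] S)
    {ϖ : S} (hϖ : Irreducible ϖ) (hgen : Algebra.adjoin R {ϖ} = ⊤)
    (h2 : 2 ≤ autDepth σ) (hσ : σ ≠ 1) : autDepth σ < autDepth (σ ^ p) := by
  obtain ⟨d, hd⟩ := ENat.ne_top_iff_exists.1 (mt (autDepth_eq_top_iff σ).1 hσ)
  have h2' : 2 ≤ d := by rw [← hd] at h2; exact_mod_cast h2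
  have hδ : ϖ ^ (d + 1) ∣ σ (σ ϖ - ϖ) - (σ ϖ - ϖ) := by
    have h := addVal_add_autDepth_le hϖ σ (le_trans (by norm_num) h2) (σ ϖ - ϖ)
    rw [← autDepth_eq_of_adjoin hgen, ← hd] at h
    rw [← addVal_le_iff_dvd, hϖ.addVal_pow]
    refine (ENat.add_le_add_iff_right ENat.one_ne_top).1 (le_trans ?_ h)
    norm_cast
    omega
  have hdvd : ∀ x, ϖ ^ d ∣ σ x - x := fun x => by
    rw [← addVal_le_iff_dvd, hϖ.addVal_pow, hd]; exact autDepth_le _ _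
  have hϖσ : ϖ ∣ σ ϖ := by
    have := (dvd_pow_self ϖ (by omega : d ≠ 0)).trans (hdvd ϖ)
    exact (dvd_sub_left (dvd_refl ϖ)).1 this
  have key : ∀ n : ℕ, ϖ ^ (d + 1) ∣ (σ ^ n) ϖ - ϖ - n * (σ ϖ - ϖ) := by
    intro n
    induction n with
    | zero => simp
    | succ n ih =>
      have h1 : (σ ^ (n + 1)) ϖ - ϖ - ((n + 1 : ℕ) : S) * (σ ϖ - ϖ) =
          σ ((σ ^ n) ϖ - ϖ - n * (σ ϖ - ϖ)) + n * (σ (σ ϖ - ϖ) - (σ ϖ - ϖ)) := by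
        have h2 : (σ ^ (n + 1)) ϖ = σ ((σ ^ n) ϖ) := by rw [pow_succ']; rfl
        rw [h2]
        simp only [map_sub, map_mul, map_natCast]
        push_cast
        ring
      rw [h1]
      refine dvd_add ?_ (hδ.mul_left _)
      have h3 := map_dvd σ ih
      rw [map_pow] at h3
      exact (pow_dvd_pow_of_dvd hϖσ _).trans h3
  have h := key p
  rw [CharP.cast_eq_zero, zero_mul, sub_zero, ← addVal_le_iff_dvd, hϖ.addVal_pow,
    ← autDepth_eq_of_adjoin hgen] at h
  rw [← hd]
  exact lt_of_lt_of_le (by exact_mod_cast Nat.lt_succ_self d) h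

end DVR

end LocalRamification

namespace LocalRamification

open Polynomial IsLocalRing
open IsDiscreteValuationRing (addVal addVal_le_iff_dvd addVal_eq_top_iff addVal_mul addVal_pow
  addVal_uniformizer addVal_eq_zero_iff addVal_add)

/-! ### Lower ramification numbers. -/

section LowerNumber

variable (R K E : Type*) [CommRing R] [IsDomain R] [IsDiscreteValuationRing R]
  [Field K] [Algebra R K] [IsFractionRing R K] [Field E] [Algebra K E] [FiniteDimensional K E]
  [Algebra R E] [IsScalarTower R K E]

/-- For `σ ≠ 1`, the largest `n` such that `σ` lies in the lower ramification group `G_n`. -/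
noncomputable def lowerNumber (σ : Gal(E/K)) : ℕ := sSup {n : ℕ | σ ∈ lowerGroup R K E n}

omit [IsDomain R] [IsDiscreteValuationRing R] in
theorem mem_lowerGroup_iff_le_autDepth [IsDiscreteValuationRing (integralClosure R E)]
    (σ : Gal(E/K)) (i : ℤ) : σ ∈ lowerGroup R K E i ↔
      ((i + 1).toNat : ℕ∞) ≤ autDepth (galRestrict R K E (integralClosure R E) σ) := by
  rw [autDepth, le_iInf_iff]
  refine forall_congr' fun x => ?_
  rw [← mem_maximalIdeal_pow_iff_le_addVal, intMaxIdeal_eq]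
  have h : (((galRestrict R K E (integralClosure R E) σ) x - x : integralClosure R E) : E) =
      σ (x : E) - x := by
    have := algebraMap_galRestrict_apply R (K := K) (L := E) (B := integralClosure R E) σ x
    change ((galRestrict R K E (integralClosure R E) σ x : integralClosure R E) : E) = _ at this
    simp [this]
  constructor
  · rintro ⟨y, hy, hyx⟩
    rw [← h, SetLike.coe_eq_coe] at hyx
    exact hyx ▸ hy
  · intro hx
    exact ⟨_, hx, h⟩

variable [Algebra.IsSeparable K E] [IsAdicComplete (maximalIdeal R) R]
  [IsAlgClosed (ResidueField R)]

-- The residue extension is algebraic over an algebraically closed field, hence trivial.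
omit [IsAdicComplete (maximalIdeal R) R] in
include K in
theorem exists_sub_algebraMap_mem_maximalIdeal [IsLocalRing (integralClosure R E)]
    (x : integralClosure R E) :
    ∃ r : R, x - algebraMap R (integralClosure R E) r ∈ maximalIdeal (integralClosure R E) := by
  have := finite_integralClosure R K E
  have := faithfulSMul_extension R K E
  have hb := IsAlgClosed.algebraMap_bijective_of_isIntegral
    (k := ResidueField R) (K := ResidueField (integralClosure R E))
  obtain ⟨c, hc⟩ := hb.2 (residue _ x)
  obtain ⟨r, rfl⟩ := residue_surjective c
  refine ⟨r, ?_⟩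
  rw [← Ideal.Quotient.eq]
  exact hc.symm

-- In `e f = [E : K]` the residue degree `f` is `1`, so the ramification index is the full degree.
omit [IsAdicComplete (maximalIdeal R) R] in
theorem addVal_algebraMap_uniformizer [IsDiscreteValuationRing (integralClosure R E)]
    {ϖ : R} (hϖ : Irreducible ϖ) :
    addVal (integralClosure R E) (algebraMap R (integralClosure R E) ϖ) =
      Module.finrank K E := by
  have := finite_integralClosure R K E
  have := faithfulSMul_extension R K E
  have := isFractionRing_integralClosure R K E
  have h := Ideal.ramificationIdx_mul_inertiaDeg_of_isLocalRing (S := integralClosure R E) K E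
    (IsDiscreteValuationRing.not_a_field R)
  have hf : (maximalIdeal R).inertiaDeg' (maximalIdeal (integralClosure R E)) = 1 := by
    rw [Ideal.inertiaDeg'_algebraMap]
    let := Ideal.Quotient.field (maximalIdeal R)
    refine finrank_eq_one (1 : integralClosure R E ⧸ maximalIdeal (integralClosure R E))
      one_ne_zero fun w => ?_
    obtain ⟨x, rfl⟩ := Ideal.Quotient.mk_surjective w
    obtain ⟨r, hr⟩ := exists_sub_algebraMap_mem_maximalIdeal R K E x
    refine ⟨Ideal.Quotient.mk _ r, ?_⟩
    rw [Algebra.smul_def, mul_one, Ideal.Quotient.algebraMap_mk_of_liesOver]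
    exact (Ideal.Quotient.eq.2 hr).symm
  obtain ⟨q, hq⟩ := IsDiscreteValuationRing.exists_irreducible (integralClosure R E)
  have h0 : algebraMap R (integralClosure R E) ϖ ≠ 0 := by simpa using hϖ.ne_zero
  obtain ⟨e, u, hu⟩ := IsDiscreteValuationRing.eq_unit_mul_pow_irreducible h0 hq
  have hval : addVal (integralClosure R E) (algebraMap R (integralClosure R E) ϖ) = e := by
    rw [hu, IsDiscreteValuationRing.addVal_def' u hq]
  have hmap : ∀ n, (maximalIdeal R).map (algebraMap R (integralClosure R E)) ≤
      maximalIdeal (integralClosure R E) ^ n ↔ n ≤ e := fun n => by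
    rw [hϖ.maximalIdeal_eq, Ideal.map_span, Set.image_singleton, Ideal.span_singleton_le_iff_mem,
      mem_maximalIdeal_pow_iff_le_addVal, hval, Nat.cast_le]
  have he := Ideal.ramificationIdx'_spec ((hmap e).2 le_rfl) (by rw [hmap]; omega)
  rw [he, hf, mul_one] at h
  rw [hval, h]

omit [IsAdicComplete (maximalIdeal R) R] in
theorem one_le_autDepth_galRestrict [IsDiscreteValuationRing (integralClosure R E)]
    (σ : Gal(E/K)) : 1 ≤ autDepth (galRestrict R K E (integralClosure R E) σ) :=
  one_le_autDepth (exists_sub_algebraMap_mem_maximalIdeal R K E) _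

-- The shift by one is that of the definition of `G_i`. Depth `d ≥ 1` makes the set of admissible
-- `n` the nonempty interval `[0, d - 1]`, so its supremum is attained.
omit [IsAdicComplete (maximalIdeal R) R] in
theorem autDepth_galRestrict [IsDiscreteValuationRing (integralClosure R E)]
    {σ : Gal(E/K)} (hσ : σ ≠ 1) :
    autDepth (galRestrict R K E (integralClosure R E) σ) = lowerNumber R K E σ + 1 := by
  have htop : autDepth (galRestrict R K E (integralClosure R E) σ) ≠ ⊤ := by
    rw [Ne, autDepth_eq_top_iff]
    simpa using hσ
  obtain ⟨d, hd⟩ := ENat.ne_top_iff_exists.1 htop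
  have h1 := one_le_autDepth_galRestrict R K E σ
  rw [← hd] at h1 ⊢
  have h1' : 1 ≤ d := by exact_mod_cast h1
  have : {n : ℕ | σ ∈ lowerGroup R K E n} = Set.Iic (d - 1) := by
    ext n
    simp only [Set.mem_ofPred_eq, Set.mem_Iic, mem_lowerGroup_iff_le_autDepth, ← hd, Nat.cast_le]
    omega
  rw [lowerNumber, this, csSup_Iic]
  norm_cast
  omega

theorem mem_lowerGroup_iff {σ : Gal(E/K)} (hσ : σ ≠ 1) (i : ℤ) :
    σ ∈ lowerGroup R K E i ↔ i ≤ lowerNumber R K E σ := by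
  have := isDiscreteValuationRing_integralClosure R K E
  rw [mem_lowerGroup_iff_le_autDepth, autDepth_galRestrict R K E hσ]
  norm_cast
  omega

end LowerNumber

end LocalRamification

namespace LocalRamification

open Polynomial IsLocalRing
open IsDiscreteValuationRing (addVal addVal_le_iff_dvd addVal_eq_top_iff addVal_mul addVal_pow
  addVal_uniformizer addVal_eq_zero_iff addVal_add)

/-! ### Herbrand functions of numbered finite groups. -/

section Herbrand

open Classical in
/-- `min v (n s)`, where the identity is given the value `n 1 = ∞`. -/
noncomputable def truncNumber {G : Type*} [Group G] (n : G → ℕ) (v : ℝ) (s : G) : ℝ :=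
  if s = 1 then v else min v (n s)

/-- The Herbrand function attached to a ramification numbering `n` of a finite group. -/
noncomputable def groupPhi {G : Type*} [Group G] [Fintype G] (n : G → ℕ) (v : ℝ) : ℝ :=
  (∑ s, truncNumber n v s) / Fintype.card G

variable {G : Type*} [Group G] (n : G → ℕ)

@[simp] theorem truncNumber_one (v : ℝ) : truncNumber n v 1 = v := if_pos rfl

theorem truncNumber_of_ne {s : G} (hs : s ≠ 1) (v : ℝ) : truncNumber n v s = min v (n s) :=
  if_neg hs

theorem truncNumber_mono (s : G) : Monotone fun v => truncNumber n v s := by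
  intro v w h
  by_cases hs : s = 1
  · simpa [hs] using h
  · simp only [truncNumber_of_ne n hs]
    exact min_le_min_right _ h

theorem continuous_truncNumber (s : G) : Continuous fun v => truncNumber n v s := by
  by_cases hs : s = 1
  · simpa [hs] using continuous_id'
  · simp only [truncNumber_of_ne n hs]
    fun_prop

theorem min_truncNumber (s : G) (v w : ℝ) :
    min v (truncNumber n w s) = truncNumber n (min v w) s := by
  by_cases hs : s = 1
  · simp [hs]
  · simp only [truncNumber_of_ne n hs, min_assoc]

variable [Fintype G]

theorem groupPhi_strictMono : StrictMono (groupPhi n) := by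
  intro v w h
  have : (0 : ℝ) < Fintype.card G := by exact_mod_cast Fintype.card_pos
  refine div_lt_div_of_pos_right ?_ this
  exact Finset.sum_lt_sum (fun s _ => truncNumber_mono n s h.le) ⟨1, Finset.mem_univ _, by simpa⟩

theorem continuous_groupPhi : Continuous (groupPhi n) :=
  (continuous_finsetSum _ fun s _ => continuous_truncNumber n s).div_const _

theorem groupPhi_of_le {v : ℝ} (h : ∀ s ≠ 1, v ≤ n s) : groupPhi n v = v := by
  have h1 : ∀ s ∈ Finset.univ, truncNumber n v s = v := fun s _ => by
    by_cases hs : s = 1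
    · simp [hs]
    · rw [truncNumber_of_ne n hs, min_eq_left (h s hs)]
  rw [groupPhi, Finset.sum_congr rfl h1]
  simp

theorem groupPhi_zero : groupPhi n 0 = 0 := groupPhi_of_le n fun s _ => by positivity

theorem exists_groupPhi_eq {u : ℝ} (hu : 0 ≤ u) : ∃ v, 0 ≤ v ∧ groupPhi n v = u := by
  have hc : (0 : ℝ) < Fintype.card G := by exact_mod_cast Fintype.card_pos
  have h2 : u ≤ groupPhi n (u * Fintype.card G) := by
    rw [groupPhi, le_div_iff₀ hc]
    have hpos : 0 ≤ u * Fintype.card G := by positivity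
    calc u * Fintype.card G = truncNumber n (u * Fintype.card G) 1 := by simp
      _ ≤ _ := Finset.single_le_sum (f := fun s => truncNumber n (u * Fintype.card G) s)
        (fun s _ => ?_) (Finset.mem_univ _)
    by_cases hs : s = 1
    · simpa [hs] using hpos
    · simp only [truncNumber_of_ne n hs]
      positivity
  obtain ⟨v, hv, hvu⟩ := intermediate_value_Icc (by positivity : 0 ≤ u * Fintype.card G)
    (continuous_groupPhi n).continuousOn ⟨(groupPhi_zero n).trans_le hu, h2⟩
  exact ⟨v, hv.1, hvu⟩

theorem sum_fiber_eq {Q : Type*} [Group Q] [DecidableEq Q] (π : G →* Q) (s₀ : G) (f : G → ℝ) :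
    ∑ s with π s = π s₀, f s = ∑ t with π t = 1, f (s₀ * t) := by
  refine Finset.sum_nbij' (fun s => s₀⁻¹ * s) (fun t => s₀ * t) ?_ ?_ ?_ ?_ ?_ <;>
    simp +contextual

theorem card_eq_card_mul_card_filter {Q : Type*} [Group Q] [Fintype Q] [DecidableEq Q] (π : G →* Q)
    (hπ : Function.Surjective π) :
    Fintype.card G = Fintype.card Q * (Finset.univ.filter fun t => π t = 1).card := by
  have h1 : Fintype.card G = ∑ q : Q, (Finset.univ.filter fun s => π s = q).card := by
    rw [← Finset.card_univ]
    exact Finset.card_eq_sum_card_fiberwise fun _ _ => Finset.mem_univ _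
  have h2 : ∀ q ∈ (Finset.univ : Finset Q),
      (Finset.univ.filter fun s => π s = q).card = (Finset.univ.filter fun t => π t = 1).card := by
    intro q _
    obtain ⟨s₀, rfl⟩ := hπ q
    have := sum_fiber_eq π s₀ (fun _ => 1)
    simp only [Finset.sum_const, nsmul_eq_mul, mul_one] at this
    exact_mod_cast this
  rw [h1, Finset.sum_congr rfl h2]
  simp

/-- Herbrand's theorem in terms of ramification numbers: if the ramification number of a
nontrivial element of a quotient group is the average of the numbers of its preimages, then its
upper number is the largest upper number of its preimages. -/
theorem groupPhi_quotient {Q : Type*} [Group Q] [Fintype Q] [DecidableEq Q] (π : G →* Q)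
    (hπ : Function.Surjective π) (m : Q → ℕ)
    (hmul : ∀ s t : G, s ≠ 1 → t ≠ 1 → s * t ≠ 1 → min (n s) (n t) ≤ n (s * t))
    (hinv : ∀ s, n s⁻¹ = n s)
    (hsum : ∀ q ≠ 1, (Finset.univ.filter fun t => π t = 1).card * m q = ∑ s with π s = q, n s)
    {s : G} (hs : π s ≠ 1) (hmax : ∀ t, π t = π s → n t ≤ n s) :
    groupPhi m (m (π s)) = groupPhi n (n s) := by
  set h := (Finset.univ.filter fun t => π t = 1).card with hh
  have hpos : (0 : ℝ) < h := by
    have : 0 < h := Finset.card_pos.2 ⟨1, by simp⟩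
    exact_mod_cast this
  -- For `s` of largest number in its coset, the ultrametric inequalities for `s * t` and for `t =
  -- s⁻¹ * (s * t)` force `n (s * t) = min (n s) (n t)`.
  have key : ∀ s : G, π s ≠ 1 → (∀ t, π t = π s → n t ≤ n s) → ∀ t, π t = 1 →
      (n (s * t) : ℝ) = truncNumber n (n s) t := by
    intro s hs hmax t ht
    by_cases ht1 : t = 1
    · simp [ht1]
    have hs1 : s ≠ 1 := by rintro rfl; simp at hs
    have hst : s * t ≠ 1 := by
      intro h0
      apply hs
      simpa [ht] using congrArg π h0
    have h1 := hmul s t hs1 ht1 hst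
    have h2 := hmax (s * t) (by simp [ht])
    have h3 := hmul s⁻¹ (s * t) (by simpa) hst (by simpa)
    rw [inv_mul_cancel_left, hinv] at h3
    rw [truncNumber_of_ne n ht1]
    norm_cast
    rcases le_total (n s) (n t) with h4 | h4
    · rw [min_eq_left h4] at h1 ⊢; omega
    · rw [min_eq_right h4] at h1 ⊢
      rcases min_le_iff.1 h3 with h5 | h5 <;> omega
  set φ : ℝ → ℝ := fun v => (∑ t with π t = 1, truncNumber n v t) / h with hφ
  have hφmono : Monotone φ := fun v w hvw =>
    div_le_div_of_nonneg_right (Finset.sum_le_sum fun t _ => truncNumber_mono n t hvw) hpos.le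
  have hm : ∀ s : G, π s ≠ 1 → (∀ t, π t = π s → n t ≤ n s) → (m (π s) : ℝ) = φ (n s) := by
    intro s hs hmax
    rw [hφ, eq_div_iff hpos.ne', mul_comm]
    have h1 := hsum (π s) hs
    calc (h : ℝ) * m (π s) = ∑ t with π t = π s, (n t : ℝ) := by exact_mod_cast h1
      _ = _ := by
        rw [sum_fiber_eq π s]
        exact Finset.sum_congr rfl fun t ht => key s hs hmax t (by simpa using ht)
  have hexmax : ∀ q : Q, ∃ s, π s = q ∧ ∀ t, π t = π s → n t ≤ n s := by
    intro q
    obtain ⟨s₀, rfl⟩ := hπ q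
    obtain ⟨s, hs, hmax⟩ := Finset.exists_max_image (Finset.univ.filter fun t => π t = π s₀) n
      ⟨s₀, by simp⟩
    simp only [Finset.mem_filter, Finset.mem_univ, true_and] at hs hmax
    exact ⟨s, hs, fun t ht => hmax t (ht.trans hs)⟩
  -- Transitivity of Herbrand functions, checked fibre by fibre: the monotone `φ` commutes with
  -- `min`.
  have htrans : ∀ v, groupPhi m (φ v) = groupPhi n v := by
    intro v
    have hfib : ∀ q : Q, truncNumber m (φ v) q * h = ∑ s with π s = q, truncNumber n v s := by
      intro q
      by_cases hq : q = 1
      · rw [hq, truncNumber_one, hφ, div_mul_cancel₀ _ hpos.ne']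
      · obtain ⟨s, rfl, hmax⟩ := hexmax q
        rw [truncNumber_of_ne m hq, hm s hq hmax, ← hφmono.map_min, hφ,
          div_mul_cancel₀ _ hpos.ne', sum_fiber_eq π s]
        refine Finset.sum_congr rfl fun t ht => ?_
        have ht' : π t = 1 := by simpa using ht
        have hst : s * t ≠ 1 := by
          intro h0
          apply hq
          simpa [ht'] using congrArg π h0
        rw [truncNumber_of_ne n hst, key s hq hmax t ht', min_truncNumber]
    have hcard : (Fintype.card G : ℝ) = Fintype.card Q * h := by
      exact_mod_cast card_eq_card_mul_card_filter π hπ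
    have hQ : (0 : ℝ) < Fintype.card Q := by exact_mod_cast Fintype.card_pos
    rw [groupPhi, groupPhi, hcard, div_eq_div_iff hQ.ne' (by positivity),
      ← Finset.sum_fiberwise (s := Finset.univ) (g := π), ← Finset.sum_congr rfl fun q _ => hfib q,
      ← Finset.sum_mul]
    ring
  rw [hm s hs hmax, htrans]

end Herbrand

/-! ### Upper jumps as values of the Herbrand function. -/

section UpperJumps

variable (R K E : Type*) [CommRing R] [IsDomain R] [IsDiscreteValuationRing R]
  [Field K] [Algebra R K] [IsFractionRing R K] [Field E] [Algebra K E] [FiniteDimensional K E]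
  [Algebra R E] [IsScalarTower R K E]
  [Algebra.IsSeparable K E] [IsAdicComplete (maximalIdeal R) R]
  [IsAlgClosed (ResidueField R)]

theorem integral_indicator_le {c : ℝ} (hc : 0 ≤ c) (v : ℝ) :
    ∫ u in (0 : ℝ)..v, (if u ≤ c then (1 : ℝ) else 0) = min v c := by
  have key : ∀ v ≤ c, ∫ u in (0 : ℝ)..v, (if u ≤ c then (1 : ℝ) else 0) = v := by
    intro v hv
    rw [intervalIntegral.integral_congr (g := fun _ => (1 : ℝ))]
    · simp
    · intro u hu
      have : u ≤ c := hu.2.trans (max_le hc hv)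
      simp [this]
  have hint : ∀ a b : ℝ, IntervalIntegrable (fun u => if u ≤ c then (1 : ℝ) else 0)
      MeasureTheory.volume a b := fun a b => by
    refine Antitone.intervalIntegrable fun u w huw => ?_
    by_cases h1 : w ≤ c
    · simp [h1, huw.trans h1]
    · simp only [h1, if_false]
      positivity
  rcases le_total v c with hv | hv
  · rw [key v hv, min_eq_left hv]
  · rw [min_eq_right hv, ← intervalIntegral.integral_add_adjacent_intervals (hint 0 c) (hint c v),
      key c le_rfl, intervalIntegral.integral_congr_ae (g := fun _ => (0 : ℝ))]
    · simp
    · filter_upwards with u hu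
      rw [Set.uIoc_of_le hv] at hu
      simp [not_le.2 hu.1]

theorem mem_lowerGroupReal_iff (σ : Gal(E/K)) (v : ℝ) :
    σ ∈ lowerGroupReal R K E v ↔ σ = 1 ∨ v ≤ lowerNumber R K E σ := by
  by_cases hσ : σ = 1
  · simp [hσ, one_mem]
  · rw [lowerGroupReal, mem_lowerGroup_iff R K E hσ, Int.ceil_le]
    simp [hσ]

/-- The integrand is `|G_u| / |G|`, and `|G_u|` is a sum over `σ` of indicators of `u ≤ i(σ)`, the
identity always counting. Each indicator integrates to `min v (i σ)`. -/
theorem herbrandPhi_eq : herbrandPhi R K E = groupPhi (lowerNumber R K E) := by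
  classical
  funext v
  have hc : (Fintype.card Gal(E/K) : ℝ) ≠ 0 := by
    exact_mod_cast Fintype.card_ne_zero
  have h1 : ∀ u : ℝ, 1 / ((lowerGroupReal R K E u).index : ℝ) =
      (∑ s, if s = 1 then (1 : ℝ) else if u ≤ lowerNumber R K E s then 1 else 0) /
        Fintype.card Gal(E/K) := by
    intro u
    have h2 := (lowerGroupReal R K E u).index_mul_card
    have h3 : (∑ s, if s = 1 then (1 : ℝ) else if u ≤ lowerNumber R K E s then 1 else 0) =
        Nat.card (lowerGroupReal R K E u) := by
      rw [Nat.card_eq_fintype_card, Fintype.card_subtype, Finset.card_filter]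
      push_cast
      refine Finset.sum_congr rfl fun s _ => ?_
      rw [mem_lowerGroupReal_iff]
      by_cases hs : s = 1 <;> simp [hs]
    rw [h3, div_eq_div_iff _ hc]
    · rw [← Nat.card_eq_fintype_card, ← h2]
      push_cast; ring
    · exact_mod_cast Subgroup.index_ne_zero_of_finite
  rw [herbrandPhi, intervalIntegral.integral_congr fun u _ => h1 u,
    intervalIntegral.integral_div, groupPhi, intervalIntegral.integral_finsetSum]
  · congr 1
    refine Finset.sum_congr rfl fun s _ => ?_
    by_cases hs : s = 1
    · simp [hs]
    · simp only [hs, if_false]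
      rw [integral_indicator_le (by positivity), truncNumber_of_ne _ hs]
  · intro s _
    refine Antitone.intervalIntegrable fun u w huw => ?_
    by_cases hs : s = 1
    · simp [hs]
    · by_cases h1 : w ≤ lowerNumber R K E s
      · simp [h1, huw.trans h1]
      · simp only [h1, if_false, hs]
        positivity

/-- Injectivity of `φ` makes the chosen inverse satisfy `ψ (φ v) = v` on `[-1, ∞)`; parametrising
upper indices as `φ v` removes `ψ` from later arguments. -/
theorem mem_upperGroup_groupPhi_iff {v : ℝ} (hv : -1 ≤ v) (σ : Gal(E/K)) :
    σ ∈ upperGroup R K E (groupPhi (lowerNumber R K E) v) ↔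
      σ = 1 ∨ v ≤ lowerNumber R K E σ := by
  have h := (groupPhi_strictMono (lowerNumber R K E)).injective.injOn.leftInvOn_invFunOn
    (show v ∈ Set.Ici (-1 : ℝ) from hv)
  rw [upperGroup, herbrandPsi, herbrandPhi_eq, h, mem_lowerGroupReal_iff]

/-- The upper jumps are the upper numbers of the nontrivial automorphisms. -/
theorem upperJumps_eq : upperJumps R K E =
    (fun σ : Gal(E/K) => groupPhi (lowerNumber R K E) (lowerNumber R K E σ)) '' {σ | σ ≠ 1} := by
  set φ := groupPhi (lowerNumber R K E) with hφ
  have hmono : StrictMono φ := groupPhi_strictMono _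
  have key : ∀ v : ℝ, 0 ≤ v → ((upperGroup R K E (φ v) : Set Gal(E/K)) ≠
      ⋃ ε ∈ Set.Ioi (0 : ℝ), (upperGroup R K E (φ v + ε) : Set Gal(E/K)) ↔
      ∃ σ : Gal(E/K), σ ≠ 1 ∧ v = lowerNumber R K E σ) := by
    intro v hv
    have hφv : 0 ≤ φ v := (groupPhi_zero _).symm.trans_le (hmono.monotone hv)
    -- Each `φ v + ε` is `φ w` for some `w > v`, so passing to the union turns `v ≤ i(σ)` into a
    -- strict inequality.
    have hU : ∀ σ, σ ∈ ⋃ ε ∈ Set.Ioi (0 : ℝ), (upperGroup R K E (φ v + ε) : Set Gal(E/K)) ↔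
        σ = 1 ∨ v < lowerNumber R K E σ := by
      intro σ
      simp only [Set.mem_iUnion, Set.mem_Ioi, SetLike.mem_coe, exists_prop]
      constructor
      · rintro ⟨ε, hε, hσ⟩
        obtain ⟨w, hw, hwε⟩ := exists_groupPhi_eq (lowerNumber R K E)
          (by linarith : 0 ≤ φ v + ε)
        rw [← hwε, mem_upperGroup_groupPhi_iff R K E (by linarith)] at hσ
        have hvw : v < w := hmono.lt_iff_lt.1 (by rw [hφ, hwε]; linarith)
        exact hσ.imp_right hvw.trans_le
      · rintro (rfl | h)
        · exact ⟨1, one_pos, one_mem _⟩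
        · refine ⟨φ (lowerNumber R K E σ) - φ v, sub_pos.2 (hmono h), ?_⟩
          rw [add_sub_cancel, mem_upperGroup_groupPhi_iff R K E (by linarith)]
          exact Or.inr le_rfl
    rw [Ne, Set.ext_iff, not_forall]
    refine exists_congr fun σ => ?_
    rw [hU, SetLike.mem_coe, mem_upperGroup_groupPhi_iff R K E (by linarith)]
    by_cases hσ : σ = 1
    · simp [hσ]
    · simp only [hσ, false_or, ne_eq, not_false_eq_true, true_and]
      constructor
      · intro h
        rcases lt_trichotomy v (lowerNumber R K E σ) with h1 | h1 | h1
        · exact absurd (iff_of_true h1.le h1) h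
        · exact h1
        · exact absurd (iff_of_false h1.not_ge h1.not_gt) h
      · rintro h h1
        exact absurd (h1.1 h.le) h.not_lt
  ext u
  constructor
  · rintro ⟨hu, hne⟩
    obtain ⟨v, hv, rfl⟩ := exists_groupPhi_eq (lowerNumber R K E) hu
    obtain ⟨σ, hσ, rfl⟩ := (key v hv).1 hne
    exact ⟨σ, hσ, rfl⟩
  · rintro ⟨σ, hσ, rfl⟩
    have h0 : (0 : ℝ) ≤ lowerNumber R K E σ := by positivity
    exact ⟨(groupPhi_zero _).symm.trans_le (hmono.monotone h0), (key _ h0).2 ⟨σ, hσ, rfl⟩⟩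

end UpperJumps

end LocalRamification

namespace LocalRamification

open Polynomial IsLocalRing
open IsDiscreteValuationRing (addVal addVal_le_iff_dvd addVal_eq_top_iff addVal_mul addVal_pow
  addVal_uniformizer addVal_eq_zero_iff addVal_add)

/-! ### Serre's formula for ramification numbers of a quotient. -/

section Tower

theorem addVal_prod {S ι : Type*} [CommRing S] [IsDomain S] [IsDiscreteValuationRing S]
    (s : Finset ι) (f : ι → S) : addVal S (∏ i ∈ s, f i) = ∑ i ∈ s, addVal S (f i) := by
  classical
  induction s using Finset.induction_on with
  | empty => simp
  | insert a s ha ih => rw [Finset.prod_insert ha, Finset.sum_insert ha, addVal_mul, ih]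

variable (R K F E : Type*) [CommRing R] [IsDomain R] [IsDiscreteValuationRing R]
  [Field K] [Algebra R K] [IsFractionRing R K] [Field E] [Algebra K E] [FiniteDimensional K E]
  [Algebra R E] [IsScalarTower R K E] [IsGalois K E] [IsAdicComplete (maximalIdeal R) R]
  [IsAlgClosed (ResidueField R)]
  [Field F] [Algebra K F] [Algebra R F] [IsScalarTower R K F] [FiniteDimensional K F]
  [IsGalois K F] [Algebra F E] [IsScalarTower K F E]

/-- Serre's formula: the ramification number of an automorphism of a Galois subextension `F/K` is
the average of the ramification numbers of its extensions to `E`. -/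
theorem card_mul_lowerNumber_eq_sum [DecidableEq Gal(F/K)] {q : Gal(F/K)} (hq : q ≠ 1) :
    (Finset.univ.filter fun t : Gal(E/K) => AlgEquiv.restrictNormalHom F t = 1).card *
      lowerNumber R K F q =
    ∑ s : Gal(E/K) with AlgEquiv.restrictNormalHom F s = q, lowerNumber R K E s := by
  have : IsScalarTower R F E := .of_algebraMap_eq fun r => by
    rw [IsScalarTower.algebraMap_apply R K E, IsScalarTower.algebraMap_apply R K F,
      ← IsScalarTower.algebraMap_apply K F E]
  set π : Gal(E/K) →* Gal(F/K) := AlgEquiv.restrictNormalHom F with hπdef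
  have hπ : Function.Surjective π := AlgEquiv.restrictNormalHom_surjective E
  set S := integralClosure R E
  set A := integralClosure R F
  have : IsDiscreteValuationRing S := isDiscreteValuationRing_integralClosure R K E
  have : IsDiscreteValuationRing A := isDiscreteValuationRing_integralClosure R K F
  have : Module.Finite R S := finite_integralClosure R K E
  have : Module.Finite R A := finite_integralClosure R K F
  have : FaithfulSMul R E := faithfulSMul_extension R K E
  have : FaithfulSMul R F := faithfulSMul_extension R K F
  let ι : A →ₐ[R] S := (IsScalarTower.toAlgHom R F E).mapIntegralClosure
  have hιE : ∀ a : A, ((ι a : S) : E) = algebraMap F E a := fun a => rfl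
  have hιinj : Function.Injective ι := fun a b h =>
    Subtype.ext ((algebraMap F E).injective (congrArg (Subtype.val : S → E) h))
  let ρ : Gal(E/K) ≃* (S ≃ₐ[R] S) := galRestrict R K E S
  let ρ' : Gal(F/K) ≃* (A ≃ₐ[R] A) := galRestrict R K F A
  have hρ : ∀ s x, ((ρ s x : S) : E) = s (x : E) := fun s x =>
    algebraMap_galRestrict_apply R (K := K) (L := E) (B := S) s x
  have hρ' : ∀ s x, ((ρ' s x : A) : F) = s (x : F) := fun s x =>
    algebraMap_galRestrict_apply R (K := K) (L := F) (B := A) s x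
  have hcomm : ∀ (s : Gal(E/K)) (a : A), ρ s (ι a) = ι (ρ' (π s) a) := fun s a => by
    refine Subtype.ext ?_
    rw [hρ, hιE, hιE, hρ']
    exact (AlgEquiv.restrictNormal_commutes s F (a : F)).symm
  set H := Finset.univ.filter fun t : Gal(E/K) => π t = 1 with hH
  have hfix : ∀ c : S, (∀ t ∈ H, ρ t c = c) → ∃ a : A, ι a = c := by
    intro c hc
    have : IsGalois F E := IsGalois.tower_top_of_isGalois K F E
    have : FiniteDimensional F E := FiniteDimensional.right K F E
    have hmem : (c : E) ∈ Set.range (algebraMap F E) := by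
      rw [IsGalois.mem_range_algebraMap_iff_fixed]
      intro τ
      have hτ : AlgEquiv.restrictScalars K τ ∈ H := by
        simp only [hH, Finset.mem_filter, Finset.mem_univ, true_and]
        ext x
        apply (algebraMap F E).injective
        have := AlgEquiv.restrictNormal_commutes (AlgEquiv.restrictScalars K τ) F x
        refine this.trans ?_
        simp
      have h := congrArg (Subtype.val : S → E) (hc _ hτ)
      rw [hρ] at h
      exact h
    obtain ⟨a, ha⟩ := hmem
    have hai : IsIntegral R a := by
      rw [← isIntegral_algebraMap_iff (algebraMap F E).injective, ha]
      exact c.2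
    exact ⟨⟨a, hai⟩, Subtype.ext ha⟩
  obtain ⟨ϖ, hϖ⟩ := IsDiscreteValuationRing.exists_irreducible S
  obtain ⟨y, hy⟩ := IsDiscreteValuationRing.exists_irreducible A
  have hgen : Algebra.adjoin R {ϖ} = ⊤ :=
    adjoin_uniformizer_eq_top (exists_sub_algebraMap_mem_maximalIdeal R K E) hϖ
  have hgen' : Algebra.adjoin R {y} = ⊤ :=
    adjoin_uniformizer_eq_top (exists_sub_algebraMap_mem_maximalIdeal R K F) hy
  obtain ⟨s₀, hs₀⟩ := hπ q
  -- the two divisibilities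
  set f : S[X] := ∏ t ∈ H, (X - C (ρ t ϖ)) with hf
  have hfs : ∀ s : Gal(E/K), f.map (ρ s : S →+* S) = ∏ t ∈ H, (X - C (ρ (s * t) ϖ)) := fun s => by
    rw [hf, Polynomial.map_prod]
    refine Finset.prod_congr rfl fun t _ => ?_
    simp
  -- The valuation of `b` is the sum of `i(s) + 1` over the `s` above `q`. It is computed by showing
  -- that `b` and `q y - y` divide each other in `S`.
  set b := ∏ t ∈ H, (ϖ - ρ (s₀ * t) ϖ) with hb
  have hevalb : (f.map (ρ s₀ : S →+* S)).eval ϖ = b := by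
    rw [hfs, eval_prod]
    simp [hb]
  have heval0 : f.eval ϖ = 0 := by
    rw [hf, eval_prod]
    exact Finset.prod_eq_zero (i := 1) (by simp [hH]) (by simp)
  -- The coefficients of `f` are fixed by `H`, so they lie in `A = R[y]`, and `s₀` moves each by a
  -- multiple of `q y - y`. Since `f(ϖ) = 0`, `b` is the value at `ϖ` of `s₀ f - f`.
  have hdvd1 : ι (ρ' q y - y) ∣ b := by
    have hcoeff : ∀ i, ι (ρ' q y - y) ∣ (f.map (ρ s₀ : S →+* S) - f).coeff i := by
      intro i
      obtain ⟨c, hc⟩ := hfix (f.coeff i) fun t ht => by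
        have h1 : f.map (ρ t : S →+* S) = f := by
          rw [hfs, hf]
          have ht' : π t = 1 := by simpa [hH] using ht
          exact Finset.prod_nbij' (fun s => t * s) (fun s => t⁻¹ * s) (by simp [hH, ht'])
            (by simp [hH, ht']) (by simp) (by simp) (by simp)
        have h2 := congrArg (fun g : S[X] => g.coeff i) h1
        simpa [coeff_map] using h2
      rw [coeff_sub, coeff_map, ← hc]
      have h3 : ((ρ s₀ : S ≃ₐ[R] S) : S →+* S) (ι c) = ι (ρ' q c) := by
        rw [← hs₀]
        exact hcomm s₀ c
      rw [h3, ← map_sub]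
      refine map_dvd ι ?_
      rw [← addVal_le_iff_dvd, ← autDepth_eq_of_adjoin hgen']
      exact autDepth_le _ _
    have h4 : b = (f.map (ρ s₀ : S →+* S) - f).eval ϖ := by
      rw [eval_sub, hevalb, heval0, sub_zero]
    rw [h4, eval_eq_sum_range]
    exact Finset.dvd_sum fun i _ => (hcoeff i).mul_right _
  -- Write `y = g(ϖ)`. Then `g(X) - y` vanishes at the distinct `H`-conjugates of `ϖ`, so `f`
  -- divides it; apply `s₀` to the coefficients and evaluate at `ϖ`.
  have hdvd2 : b ∣ ι (ρ' q y - y) := by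
    have hx : ι y ∈ Algebra.adjoin R {ϖ} := hgen ▸ Algebra.mem_top
    rw [Algebra.adjoin_singleton_eq_range_aeval] at hx
    obtain ⟨g, hg⟩ := hx
    replace hg : aeval ϖ g = ι y := hg
    have hroot : ∀ t ∈ H, (g.map (algebraMap R S) - C (ι y)).eval (ρ t ϖ) = 0 := by
      intro t ht
      have ht' : π t = 1 := by simpa [hH] using ht
      rw [eval_sub, eval_C, eval_map, ← aeval_def, aeval_algHom_apply, hg, hcomm, ht']
      simp
    have hinj : Set.InjOn (fun t => ρ t ϖ) H := by
      intro t _ t' _ h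
      apply ρ.injective
      apply AlgEquiv.coe_toAlgHom_injective
      refine AlgHom.ext_of_adjoin_eq_top hgen ?_
      simpa using h
    have hdvd : f ∣ g.map (algebraMap R S) - C (ι y) := by
      by_cases h0 : g.map (algebraMap R S) - C (ι y) = 0
      · rw [h0]; exact dvd_zero _
      have h1 : f = (((H.val.map fun t => ρ t ϖ)).map fun a => X - C a).prod := by
        rw [Multiset.map_map]; rfl
      rw [h1, Multiset.prod_X_sub_C_dvd_iff_le_roots h0, Multiset.le_iff_subset]
      · intro a ha
        obtain ⟨t, ht, rfl⟩ := Multiset.mem_map.1 ha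
        exact (mem_roots h0).2 (hroot t ht)
      · exact Multiset.Nodup.map_on (fun t ht t' ht' h => hinj ht ht' h) H.nodup
    obtain ⟨k, hk⟩ := hdvd
    have h2 := congrArg (fun P : S[X] => (P.map (ρ s₀ : S →+* S)).eval ϖ) hk
    simp only [Polynomial.map_mul, eval_mul, hevalb, Polynomial.map_sub, Polynomial.map_map,
      map_C, eval_sub, eval_C] at h2
    have h3 : ((ρ s₀ : S →+* S).comp (algebraMap R S)) = algebraMap R S := by
      ext r; simp
    have h4 : (ρ s₀ : S →+* S) (ι y) = ι (ρ' q y) := by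
      rw [← hs₀]
      exact hcomm s₀ y
    rw [h3, h4, eval_map, ← aeval_def, hg, ← map_sub] at h2
    rw [← dvd_neg, ← map_neg, neg_sub, h2]
    exact dvd_mul_right _ _
  -- comparison of the valuations
  have hval : ∀ a : A, a ≠ 0 → ∀ n : ℕ, addVal A a = n → addVal S (ι a) = (H.card * n : ℕ) := by
    -- A uniformizer of `R` has valuation `[F : K]` in `A` and `[E : K]` in `S`; the ratio is `|H|`.
    have hy' : addVal S (ι y) = H.card := by
      obtain ⟨r, hr⟩ := IsDiscreteValuationRing.exists_irreducible R
      have h1 := addVal_algebraMap_uniformizer R K E hr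
      have h2 := addVal_algebraMap_uniformizer R K F hr
      have hr0 : algebraMap R A r ≠ 0 := by simpa using hr.ne_zero
      obtain ⟨e, u, hu⟩ := IsDiscreteValuationRing.eq_unit_mul_pow_irreducible hr0 hy
      rw [hu, IsDiscreteValuationRing.addVal_def' u hy] at h2
      have h3 : e = Module.finrank K F := by exact_mod_cast h2
      have hιy0 : ι y ≠ 0 := by
        simpa using (map_ne_zero_iff ι hιinj).2 hy.ne_zero
      obtain ⟨m, hm⟩ := ENat.ne_top_iff_exists.1 (mt (addVal_eq_top_iff (a := ι y)).1 hιy0)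
      have h4 : algebraMap R S r = (Units.map (ι : A →* S) u : Sˣ) * ι y ^ e := by
        rw [← ι.commutes, hu, map_mul, map_pow]; rfl
      rw [h4, addVal_mul, IsDiscreteValuationRing.addVal_eq_zero_of_unit, zero_add, addVal_pow,
        ← hm, h3] at h1
      have h5 : Module.finrank K F * m = Module.finrank K E := by
        rw [nsmul_eq_mul] at h1; exact_mod_cast h1
      have h6 := card_eq_card_mul_card_filter π hπ
      rw [← Nat.card_eq_fintype_card, ← Nat.card_eq_fintype_card, IsGalois.card_aut_eq_finrank,
        IsGalois.card_aut_eq_finrank, ← h5] at h6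
      have h7 : m = H.card := Nat.eq_of_mul_eq_mul_left Module.finrank_pos h6
      rw [← hm, h7]
    intro a ha n hn
    obtain ⟨e, u, rfl⟩ := IsDiscreteValuationRing.eq_unit_mul_pow_irreducible ha hy
    rw [IsDiscreteValuationRing.addVal_def' u hy] at hn
    have : e = n := by exact_mod_cast hn
    have h4 : ι (u * y ^ e) = (Units.map (ι : A →* S) u : Sˣ) * ι y ^ e := by
      rw [map_mul, map_pow]; rfl
    rw [h4, addVal_mul, IsDiscreteValuationRing.addVal_eq_zero_of_unit, zero_add, addVal_pow, hy',
      this, nsmul_eq_mul]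
    push_cast
    ring
  have hd : addVal A (ρ' q y - y) = (lowerNumber R K F q + 1 : ℕ) := by
    rw [← autDepth_eq_of_adjoin hgen', autDepth_galRestrict R K F hq]; simp
  have hd0 : ρ' q y - y ≠ 0 := by
    intro h; rw [h, (addVal A).map_zero] at hd; exact ENat.top_ne_natCast _ hd
  have hb' : addVal S b = (∑ t ∈ H, (lowerNumber R K E (s₀ * t) + 1) : ℕ) := by
    rw [hb, addVal_prod]
    push_cast
    refine Finset.sum_congr rfl fun t ht => ?_
    have hne : s₀ * t ≠ 1 := by
      intro h
      have ht' : π t = 1 := by simpa [hH] using ht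
      have := congrArg π h
      rw [map_mul, hs₀, ht', mul_one, map_one] at this
      exact hq this
    rw [← (addVal S).map_neg, neg_sub, ← autDepth_eq_of_adjoin hgen,
      autDepth_galRestrict R K E hne]
  have hfinal : addVal S b = addVal S (ι (ρ' q y - y)) :=
    le_antisymm (addVal_le_iff_dvd.2 hdvd2) (addVal_le_iff_dvd.2 hdvd1)
  rw [hb', hval _ hd0 _ hd, Nat.cast_inj, Finset.sum_add_distrib] at hfinal
  have hsum : ∑ s with π s = q, lowerNumber R K E s = ∑ t ∈ H, lowerNumber R K E (s₀ * t) := by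
    have := sum_fiber_eq π s₀ (fun s => (lowerNumber R K E s : ℝ))
    rw [hs₀] at this
    exact_mod_cast this
  rw [hsum]
  simp only [Finset.sum_const, smul_eq_mul, mul_one] at hfinal
  linarith

end Tower

end LocalRamification

/-! ### Counting jumps, passage to subextensions, cyclic extensions of degree `p ^ 2`. -/

namespace LocalRamification

open Polynomial IsLocalRing
open IsDiscreteValuationRing (addVal addVal_le_iff_dvd addVal_eq_top_iff addVal_mul addVal_pow
  addVal_uniformizer addVal_eq_zero_iff addVal_add)

/-- A subgroup of order `m` lies in the solution set of `a ^ m = 1`, which has at most `m` elements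
in a cyclic group, and so equals it. -/
theorem eq_of_card_eq_of_isCyclic {G : Type*} [Group G] [Finite G] [IsCyclic G]
    {H H' : Subgroup G} (h : Nat.card H = Nat.card H') : H = H' := by
  classical
  have := Fintype.ofFinite G
  have key : ∀ H₁ : Subgroup G, (H₁ : Set G) =
      (Finset.univ.filter fun a : G => a ^ Nat.card H₁ = 1 : Finset G) := by
    intro H₁
    have hsub : (Finset.univ.filter fun a : G => a ∈ H₁) ⊆
        Finset.univ.filter fun a : G => a ^ Nat.card H₁ = 1 := by
      intro a ha
      simp only [Finset.mem_filter, Finset.mem_univ, true_and] at ha ⊢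
      have := pow_card_eq_one' (x := (⟨a, ha⟩ : H₁))
      exact congrArg Subtype.val this
    have heq := Finset.eq_of_subset_of_card_le hsub (by
      refine (IsCyclic.card_pow_eq_one_le Nat.card_pos).trans ?_
      rw [Nat.card_eq_fintype_card, Fintype.card_subtype])
    rw [← heq]
    ext a; simp
  apply SetLike.coe_injective
  rw [key H, key H', h]

section

variable (R K E : Type*) [CommRing R] [IsDomain R] [IsDiscreteValuationRing R]
  [Field K] [Algebra R K] [IsFractionRing R K] [Field E] [Algebra K E] [FiniteDimensional K E]
  [Algebra R E] [IsScalarTower R K E] [IsGalois K E] [IsAdicComplete (maximalIdeal R) R]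
  [IsAlgClosed (ResidueField R)]

theorem lowerNumber_inv (σ : Gal(E/K)) : lowerNumber R K E σ⁻¹ = lowerNumber R K E σ := by
  have := isDiscreteValuationRing_integralClosure R K E
  by_cases hσ : σ = 1
  · simp [hσ]
  have h := autDepth_galRestrict R K E hσ
  have h' := autDepth_galRestrict R K E (inv_ne_one.2 hσ)
  rw [map_inv, autDepth_inv, h] at h'
  norm_cast at h'
  omega

theorem min_lowerNumber_le_lowerNumber_mul {σ τ : Gal(E/K)} (hσ : σ ≠ 1) (hτ : τ ≠ 1)
    (h : σ * τ ≠ 1) :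
    min (lowerNumber R K E σ) (lowerNumber R K E τ) ≤ lowerNumber R K E (σ * τ) := by
  have := isDiscreteValuationRing_integralClosure R K E
  have h1 := min_autDepth_le_autDepth_mul (galRestrict R K E (integralClosure R E) σ)
    (galRestrict R K E (integralClosure R E) τ)
  rw [← map_mul, autDepth_galRestrict R K E hσ, autDepth_galRestrict R K E hτ,
    autDepth_galRestrict R K E h] at h1
  rcases min_le_iff.1 h1 with h2 | h2 <;> norm_cast at h2 <;> omega

theorem lowerNumber_le_lowerNumber_pow {σ : Gal(E/K)} {k : ℕ} (h : σ ^ k ≠ 1) :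
    lowerNumber R K E σ ≤ lowerNumber R K E (σ ^ k) := by
  have := isDiscreteValuationRing_integralClosure R K E
  have hσ : σ ≠ 1 := by rintro rfl; simp at h
  have h1 := autDepth_pow_le (galRestrict R K E (integralClosure R E) σ) k
  rw [← map_pow, autDepth_galRestrict R K E hσ, autDepth_galRestrict R K E h] at h1
  norm_cast at h1
  omega

section CharP

variable {p : ℕ} [Fact p.Prime] [CharP K p]

include K p in
omit [IsGalois K E] [IsAdicComplete (maximalIdeal R) R] [IsAlgClosed (ResidueField R)]
  [Fact p.Prime] [FiniteDimensional K E] [IsFractionRing R K] [IsDomain R]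
  [IsDiscreteValuationRing R] [IsScalarTower R K E] [Algebra R K] in
theorem charP_integralClosure : CharP (integralClosure R E) p := by
  have : CharP E p := charP_of_injective_algebraMap (algebraMap K E).injective p
  exact RingHom.charP (algebraMap (integralClosure R E) E) Subtype.val_injective p

omit [IsAdicComplete (maximalIdeal R) R] in
theorem two_le_autDepth_galRestrict [IsDiscreteValuationRing (integralClosure R E)]
    {σ : Gal(E/K)} {k : ℕ} (h : σ ^ p ^ k = 1) :
    2 ≤ autDepth (galRestrict R K E (integralClosure R E) σ) := by
  have : CharP (integralClosure R E) p := charP_integralClosure R K E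
  have := finite_integralClosure R K E
  have := faithfulSMul_extension R K E
  refine two_le_autDepth (p := p) (exists_sub_algebraMap_mem_maximalIdeal R K E) _ (k := k) ?_
  rw [← map_pow, h, map_one]

theorem lowerNumber_lt_lowerNumber_pow {σ : Gal(E/K)} {k : ℕ} (h : σ ^ p ^ k = 1)
    (hp : σ ^ p ≠ 1) : lowerNumber R K E σ < lowerNumber R K E (σ ^ p) := by
  have := isDiscreteValuationRing_integralClosure R K E
  have : CharP (integralClosure R E) p := charP_integralClosure R K E
  have := finite_integralClosure R K E
  have := faithfulSMul_extension R K E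
  have hσ : σ ≠ 1 := by rintro rfl; simp at hp
  obtain ⟨ϖ, hϖ⟩ := IsDiscreteValuationRing.exists_irreducible (integralClosure R E)
  have hgen : Algebra.adjoin R {ϖ} = ⊤ :=
    adjoin_uniformizer_eq_top (exists_sub_algebraMap_mem_maximalIdeal R K E) hϖ
  have h1 := autDepth_lt_autDepth_pow (p := p) _ hϖ hgen (two_le_autDepth_galRestrict R K E h)
    (by simpa using hσ)
  rw [← map_pow, autDepth_galRestrict R K E hσ, autDepth_galRestrict R K E hp] at h1
  norm_cast at h1
  omega

end CharP

/-- The upper number of `σ ≠ 1`: the largest `v` such that `σ ∈ G^v`. -/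
noncomputable def upperNumber (σ : Gal(E/K)) : ℝ :=
  groupPhi (lowerNumber R K E) (lowerNumber R K E σ)

theorem upperJumps_eq_image : upperJumps R K E = upperNumber R K E '' {σ | σ ≠ 1} :=
  upperJumps_eq R K E

/-- A ramification number `m` is sent to `k` with `|G_m| = p ^ k`. At a jump the group is
nontrivial, so `1 ≤ k ≤ n`; just past it the group shrinks, so `k` determines the jump. -/
theorem ncard_upperJumps_le {p n : ℕ} (hp : p.Prime) (h : Module.finrank K E = p ^ n) :
    (upperJumps R K E).ncard ≤ n := by
  have hJ : upperJumps R K E =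
      (fun m : ℕ => groupPhi (lowerNumber R K E) m) '' (lowerNumber R K E '' {σ | σ ≠ 1}) := by
    rw [upperJumps_eq, Set.image_image]
  rw [hJ]
  have hfin : (lowerNumber R K E '' {σ | σ ≠ 1}).Finite := Set.toFinite _
  refine (Set.ncard_image_le hfin).trans ?_
  have hcard : ∀ m : ℕ, ∃ k ≤ n, Nat.card (lowerGroup R K E m) = p ^ k := fun m => by
    rw [← Nat.dvd_prime_pow hp, ← h, ← IsGalois.card_aut_eq_finrank]
    exact Subgroup.card_subgroup_dvd_card _
  choose k hkn hk using hcard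
  have h2 : (lowerNumber R K E '' {σ | σ ≠ 1}).ncard ≤ (Set.Icc 1 n).ncard := by
    refine Set.ncard_le_ncard_of_injOn k ?_ ?_ (Set.toFinite _)
    · rintro _ ⟨σ, hσ, rfl⟩
      refine ⟨Nat.one_le_iff_ne_zero.2 fun h0 => ?_, hkn _⟩
      have h1 := hk (lowerNumber R K E σ)
      rw [h0, pow_zero, Subgroup.card_eq_one] at h1
      have h2 : σ ∈ lowerGroup R K E (lowerNumber R K E σ) :=
        (mem_lowerGroup_iff R K E hσ _).2 le_rfl
      rw [h1] at h2
      exact hσ (Subgroup.mem_bot.1 h2)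
    · have key : ∀ σ τ : Gal(E/K), σ ≠ 1 → τ ≠ 1 →
          k (lowerNumber R K E σ) = k (lowerNumber R K E τ) →
          ¬ lowerNumber R K E σ < lowerNumber R K E τ := by
        intro σ τ hσ hτ he hlt
        have h3 : lowerGroup R K E (lowerNumber R K E τ) ≤
            lowerGroup R K E (lowerNumber R K E σ) := by
          intro ρ hρ
          by_cases h1 : ρ = 1
          · rw [h1]; exact one_mem _
          · rw [mem_lowerGroup_iff R K E h1] at hρ ⊢
            omega
        have h4 := Subgroup.eq_of_le_of_card_ge h3 (by rw [hk, hk, he])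
        have h5 : σ ∈ lowerGroup R K E (lowerNumber R K E τ) :=
          h4 ▸ (mem_lowerGroup_iff R K E hσ _).2 le_rfl
        rw [mem_lowerGroup_iff R K E hσ] at h5
        omega
      rintro _ ⟨σ, hσ, rfl⟩ _ ⟨τ, hτ, rfl⟩ he
      exact le_antisymm (not_lt.1 (key τ σ hτ hσ he.symm)) (not_lt.1 (key σ τ hσ hτ he))
  simpa [Set.ncard_eq_toFinset_card'] using h2

theorem upperJumps_eq_triple {p : ℕ} (hp : p.Prime) (h : Module.finrank K E = p ^ 3)
    {a b c : ℝ} (hab : a ≠ b) (hac : a ≠ c) (hbc : b ≠ c) (ha : a ∈ upperJumps R K E)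
    (hb : b ∈ upperJumps R K E) (hc : c ∈ upperJumps R K E) : upperJumps R K E = {a, b, c} := by
  have hfin : (upperJumps R K E).Finite := by
    rw [upperJumps_eq]; exact Set.toFinite _
  refine (Set.eq_of_subset_of_ncard_le ?_ ?_ hfin).symm
  · rintro x (rfl | rfl | rfl) <;> assumption
  · rw [Set.ncard_eq_three.2 ⟨a, b, c, hab, hac, hbc, rfl⟩]
    exact ncard_upperJumps_le R K E hp h

variable (F : Type*) [Field F] [Algebra K F] [Algebra R F] [IsScalarTower R K F]
  [FiniteDimensional K F] [IsGalois K F] [Algebra F E] [IsScalarTower K F E]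

/-- The lift is one of largest ramification number above `q`; Serre's formula is the averaging
hypothesis of `groupPhi_quotient`. -/
theorem exists_upperNumber_restrict_eq {q : Gal(F/K)} (hq : q ≠ 1) :
    ∃ s : Gal(E/K), AlgEquiv.restrictNormalHom F s = q ∧
      upperNumber R K F q = upperNumber R K E s := by
  classical
  obtain ⟨s₀, hs₀⟩ := AlgEquiv.restrictNormalHom_surjective (F := K) (K₁ := F) E q
  obtain ⟨s, hs, hmax⟩ := Finset.exists_max_image
    (Finset.univ.filter fun t : Gal(E/K) => AlgEquiv.restrictNormalHom F t = q)
    (lowerNumber R K E) ⟨s₀, by simpa using hs₀⟩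
  simp only [Finset.mem_filter, Finset.mem_univ, true_and] at hs hmax
  refine ⟨s, hs, ?_⟩
  have h := groupPhi_quotient (lowerNumber R K E) (AlgEquiv.restrictNormalHom F)
    (AlgEquiv.restrictNormalHom_surjective E) (lowerNumber R K F)
    (fun s t h1 h2 h3 => min_lowerNumber_le_lowerNumber_mul R K E h1 h2 h3)
    (lowerNumber_inv R K E) (fun q hq => card_mul_lowerNumber_eq_sum R K F E hq)
    (s := s) (hs ▸ hq) (fun t ht => hmax t (ht.trans hs))
  rwa [hs] at h

/-- Upper jumps of a Galois subextension are upper jumps. -/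
theorem upperJumps_subset : upperJumps R K F ⊆ upperJumps R K E := by
  rw [upperJumps_eq_image, upperJumps_eq_image]
  rintro _ ⟨q, hq, rfl⟩
  obtain ⟨s, hs, h⟩ := exists_upperNumber_restrict_eq R K E F hq
  refine ⟨s, ?_, h.symm⟩
  rintro rfl
  exact hq (by simpa using hs.symm)

section Cyclic

variable {p : ℕ} [Fact p.Prime] [CharP K p]

/-- In a cyclic group, elements of equal order are powers of each other, and taking a power does not
decrease the number. -/
theorem lowerNumber_eq_of_orderOf_eq [IsCyclic Gal(E/K)] {σ τ : Gal(E/K)} (hσ : σ ≠ 1)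
    (h : orderOf σ = orderOf τ) : lowerNumber R K E σ = lowerNumber R K E τ := by
  have hτ : τ ≠ 1 := by
    rintro rfl
    rw [orderOf_one, orderOf_eq_one_iff] at h
    exact hσ h
  have key : ∀ σ τ : Gal(E/K), σ ≠ 1 → orderOf σ = orderOf τ →
      lowerNumber R K E τ ≤ lowerNumber R K E σ := by
    intro σ τ hσ h
    have h1 : Subgroup.zpowers σ = Subgroup.zpowers τ :=
      eq_of_card_eq_of_isCyclic (by rwa [Nat.card_zpowers, Nat.card_zpowers])
    have h2 : σ ∈ Subgroup.zpowers τ := h1 ▸ Subgroup.mem_zpowers σ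
    obtain ⟨k, rfl⟩ := (mem_powers_iff_mem_zpowers).2 h2
    exact lowerNumber_le_lowerNumber_pow R K E hσ
  exact le_antisymm (key τ σ hτ h.symm) (key σ τ hσ h)

/-- A cyclic extension of degree `p ^ 2` has exactly two upper jumps, and the smaller one is the
only upper jump of its subextension of degree `p`. -/
theorem exists_upperJumps_eq_pair [IsCyclic Gal(E/K)] (hE : Module.finrank K E = p ^ 2)
    (hF : Module.finrank K F = p) :
    ∃ u₀ u₁ : ℝ, u₀ < u₁ ∧ upperJumps R K E = {u₀, u₁} ∧ upperJumps R K F = {u₀} := by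
  have hp : p.Prime := Fact.out
  obtain ⟨g, hg⟩ := IsCyclic.exists_generator (α := Gal(E/K))
  have hcard : Nat.card Gal(E/K) = p ^ 2 := by rw [IsGalois.card_aut_eq_finrank, hE]
  have hordg : orderOf g = p ^ 2 := by
    rw [orderOf_eq_card_of_forall_mem_zpowers hg, hcard]
  have hpow : ∀ s : Gal(E/K), s ^ p ^ 2 = 1 := fun s => by rw [← hcard, pow_card_eq_one']
  have hgp : g ^ p ≠ 1 := by
    intro h
    have := orderOf_dvd_of_pow_eq_one h
    rw [hordg] at this
    have := Nat.le_of_dvd hp.pos this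
    nlinarith [hp.two_le]
  have hordp : orderOf (g ^ p) = p :=
    orderOf_eq_prime (by rw [← pow_mul, ← pow_two, hpow]) hgp
  have hg1 : g ≠ 1 := by rintro rfl; simp at hgp
  have hA : ∀ s : Gal(E/K), s ^ p ≠ 1 → lowerNumber R K E s = lowerNumber R K E g := by
    intro s hs
    refine lowerNumber_eq_of_orderOf_eq R K E (by rintro rfl; simp at hs) ?_
    rw [hordg]
    exact orderOf_eq_prime_pow (n := 1) (by simpa using hs) (hpow s)
  have hB : ∀ s : Gal(E/K), s ≠ 1 → s ^ p = 1 →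
      lowerNumber R K E s = lowerNumber R K E (g ^ p) := by
    intro s hs hs'
    refine lowerNumber_eq_of_orderOf_eq R K E hs ?_
    rw [hordp, orderOf_eq_prime hs' hs]
  refine ⟨upperNumber R K E g, upperNumber R K E (g ^ p), ?_, ?_, ?_⟩
  · refine groupPhi_strictMono _ ?_
    exact_mod_cast lowerNumber_lt_lowerNumber_pow R K E (hpow g) hgp
  · rw [upperJumps_eq_image]
    ext u
    constructor
    · rintro ⟨s, hs, rfl⟩
      by_cases h : s ^ p = 1
      · right; simp only [Set.mem_singleton_iff, upperNumber, hB s hs h]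
      · left; simp only [upperNumber, hA s h]
    · rintro (rfl | rfl)
      · exact ⟨g, hg1, rfl⟩
      · exact ⟨g ^ p, hgp, rfl⟩
  · have hcardF : Nat.card Gal(F/K) = p := by rw [IsGalois.card_aut_eq_finrank, hF]
    -- A lift `s` with `s ^ p = 1` would be a power of `g ^ p`, which acts trivially on `F`; so
    -- every lift of `q ≠ 1` has order `p ^ 2`.
    have hq : ∀ q : Gal(F/K), q ≠ 1 → upperNumber R K F q = upperNumber R K E g := by
      intro q hq
      obtain ⟨s, rfl, h⟩ := exists_upperNumber_restrict_eq R K E F hq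
      rw [h, upperNumber, upperNumber, hA s]
      intro hs
      apply hq
      obtain ⟨k, rfl⟩ := (mem_powers_iff_mem_zpowers).2 (hg s)
      change (g ^ k) ^ p = 1 at hs
      rw [← pow_mul] at hs
      have h1 := orderOf_dvd_of_pow_eq_one hs
      rw [hordg, pow_two] at h1
      obtain ⟨j, rfl⟩ := Nat.dvd_of_mul_dvd_mul_right hp.pos h1
      change AlgEquiv.restrictNormalHom F (g ^ (p * j)) = 1
      rw [map_pow, pow_mul, ← hcardF, pow_card_eq_one', one_pow]
    rw [upperJumps_eq_image]
    have : Nontrivial Gal(F/K) := Finite.one_lt_card_iff_nontrivial.1 (hcardF ▸ hp.one_lt)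
    obtain ⟨q, hq1⟩ := exists_ne (1 : Gal(F/K))
    ext u
    constructor
    · rintro ⟨q, hq', rfl⟩
      exact hq q hq'
    · rintro rfl
      exact ⟨q, hq1, hq q hq1⟩

end Cyclic

end

end LocalRamification

namespace LocalRamification

open Polynomial IsLocalRing
open IsDiscreteValuationRing (addVal addVal_le_iff_dvd addVal_eq_top_iff addVal_mul addVal_pow
  addVal_uniformizer addVal_eq_zero_iff addVal_add)

/-! ### Valuations and the jump of an Artin–Schreier extension. -/

section ArtinSchreier

variable {R K : Type*} [CommRing R] [IsDomain R] [IsDiscreteValuationRing R]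
  [Field K] [Algebra R K] [IsFractionRing R K]

theorem ord_unit_mul_zpow {ϖ : R} (hϖ : Irreducible ϖ) (u : Rˣ) (k : ℤ) :
    ord R K (algebraMap R K u * algebraMap R K ϖ ^ k) = k := by
  have h1 : (IsDiscreteValuationRing.maximalIdeal R).valuation K (algebraMap R K ϖ) =
      WithZero.exp (-1 : ℤ) := by
    rw [IsDedekindDomain.HeightOneSpectrum.valuation_of_algebraMap]
    exact IsDedekindDomain.HeightOneSpectrum.intValuation_singleton _ hϖ.ne_zero hϖ.maximalIdeal_eq
  have h2 : (IsDiscreteValuationRing.maximalIdeal R).valuation K (algebraMap R K u) = 1 := by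
    rw [IsDedekindDomain.HeightOneSpectrum.valuation_of_algebraMap]
    by_contra h
    have h3 := (IsDiscreteValuationRing.maximalIdeal R).intValuation_lt_one_iff_mem (u : R)
    have h4 := ((IsDiscreteValuationRing.maximalIdeal R).intValuation_le_one (u : R)).lt_of_ne h
    exact (mem_maximalIdeal _).1 (h3.1 h4) u.isUnit
  rw [ord, map_mul, map_zpow₀, h1, h2, one_mul, WithZero.log_zpow, WithZero.log_exp]
  simp

theorem exists_eq_unit_mul_zpow {ϖ : R} (hϖ : Irreducible ϖ) {x : K} (hx : x ≠ 0) :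
    ∃ u : Rˣ, x = algebraMap R K u * algebraMap R K ϖ ^ ord R K x := by
  obtain ⟨k, u, h⟩ := IsDiscreteValuationRing.exists_units_eq_smul_zpow_of_irreducible hϖ hx
  have h' : x = algebraMap R K u * algebraMap R K ϖ ^ k := by
    rw [h]; simp [Units.smul_def, Algebra.smul_def]
  refine ⟨u, ?_⟩
  have : ord R K x = k := by rw [h', ord_unit_mul_zpow hϖ]
  rwa [this]

/-- Elements of positive valuation are of the form `x ^ p - x`. -/
theorem exists_pow_sub_self_eq {p : ℕ} [Fact p.Prime] [CharP K p]
    [IsAdicComplete (maximalIdeal R) R] {γ : K} (h : 0 < ord R K γ) :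
    ∃ x : K, x ^ p - x = γ := by
  have hp : p.Prime := Fact.out
  have hγ : γ ≠ 0 := by
    rintro rfl
    simp [ord] at h
  have : CharP R p := RingHom.charP (algebraMap R K) (IsFractionRing.injective R K) p
  obtain ⟨ϖ, hϖ⟩ := IsDiscreteValuationRing.exists_irreducible R
  obtain ⟨u, hu⟩ := exists_eq_unit_mul_zpow hϖ hγ
  obtain ⟨t, ht⟩ : ∃ t : ℕ, ord R K γ = t := ⟨(ord R K γ).toNat, by omega⟩
  have ht0 : t ≠ 0 := by omega
  rw [ht, zpow_natCast, ← map_pow, ← map_mul] at hu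
  have hr : (u : R) * ϖ ^ t ∈ maximalIdeal R :=
    Ideal.mul_mem_left _ _ (Ideal.pow_mem_of_mem _
      ((mem_maximalIdeal _).2 hϖ.not_isUnit) _ (Nat.pos_of_ne_zero ht0))
  -- Hensel for `X ^ p - X - γ` at the approximate root `0`, where the derivative is `-1`.
  obtain ⟨a, ha, -⟩ := HenselianRing.is_henselian (I := maximalIdeal R)
    (X ^ p + (-X - C ((u : R) * ϖ ^ t)) : R[X])
    (monic_X_pow_add (by
      refine lt_of_le_of_lt (b := (1 : WithBot ℕ)) ?_ (by exact_mod_cast hp.one_lt)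
      compute_degree!)) 0 (by simpa [hp.ne_zero] using hr)
    (by simp [derivative_pow, CharP.cast_eq_zero])
  refine ⟨algebraMap R K a, ?_⟩
  have h1 : a ^ p + (-a - u * ϖ ^ t) = 0 := by simpa [IsRoot] using ha
  rw [hu, ← map_pow, ← map_sub]
  congr 1
  linear_combination h1

/-- The upper jump of an Artin–Schreier extension. -/
theorem upperJumps_artinSchreier {p : ℕ} [Fact p.Prime] [CharP K p]
    [IsAdicComplete (maximalIdeal R) R] [IsAlgClosed (ResidueField R)]
    {N : Type*} [Field N] [Algebra K N] [Algebra R N] [IsScalarTower R K N]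
    [FiniteDimensional K N] [IsGalois K N] (hN : Module.finrank K N = p) {y : N} {γ : K}
    (hy : y ^ p - y = algebraMap K N γ) (hgen : IntermediateField.adjoin K {y} = ⊤)
    (hγ : ord R K γ < 0) (hpγ : ¬ (p : ℤ) ∣ ord R K γ) :
    upperJumps R K N = {-(ord R K γ : ℝ)} := by
  have hp : p.Prime := Fact.out
  have hp1 : p ≠ 0 := hp.ne_zero
  have hp2 : p - 1 ≠ 0 := by have := hp.two_le; omega
  have hpp : p - 1 + 1 = p := by omega
  have hγ0 : γ ≠ 0 := by
    rintro rfl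
    simp [ord] at hγ
  have : CharP N p := charP_of_injective_algebraMap (algebraMap K N).injective p
  have hy0 : y ≠ 0 := by
    rintro rfl
    rw [zero_pow hp1, sub_zero] at hy
    exact hγ0 ((map_eq_zero _).1 hy.symm)
  obtain ⟨ϖ, hϖ⟩ := IsDiscreteValuationRing.exists_irreducible R
  obtain ⟨u, hu⟩ := exists_eq_unit_mul_zpow hϖ hγ0
  obtain ⟨t, ht⟩ : ∃ t : ℕ, ord R K γ = -t := ⟨(-ord R K γ).toNat, by omega⟩
  have ht0 : t ≠ 0 := by omega
  have hpt : ¬ p ∣ t := by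
    rw [ht, dvd_neg] at hpγ
    exact_mod_cast hpγ
  set r : R := (u⁻¹ : Rˣ) * ϖ ^ t with hr
  have hϖ0 : algebraMap R K ϖ ≠ 0 := by simpa using hϖ.ne_zero
  have hrγ : algebraMap R K r * γ = 1 := by
    rw [hu, ht, zpow_neg, zpow_natCast, hr, map_mul, map_pow]
    have h1 : algebraMap R K ((u⁻¹ : Rˣ) : R) * algebraMap R K u = 1 := by
      rw [← map_mul]; simp
    field_simp
    linear_combination h1
  -- With `r = γ⁻¹ ∈ R`, this makes `z = y⁻¹` integral. As `1 - z ^ (p - 1)` turns out to be a unit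
  -- and `r` has valuation `p t` in `N`, `z` has valuation `t`, prime to `p`.
  have hz : y⁻¹ ^ p = algebraMap R N r * (1 - y⁻¹ ^ (p - 1)) := by
    have h1 : algebraMap R N r * (y ^ p - y) = 1 := by
      rw [hy, IsScalarTower.algebraMap_apply R K N, ← map_mul, hrγ, map_one]
    have h2 : y ^ p = y ^ (p - 1) * y := by rw [← pow_succ, hpp]
    rw [inv_pow, inv_pow, h2]
    rw [h2] at h1
    field_simp
    linear_combination -h1
  have hzint : IsIntegral R y⁻¹ := by
    refine ⟨X ^ p + C r * (X ^ (p - 1) - 1), monic_X_pow_add ?_, ?_⟩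
    · refine lt_of_le_of_lt (b := ((p - 1 : ℕ) : WithBot ℕ)) ?_
        (by exact_mod_cast Nat.sub_lt hp.pos one_pos)
      compute_degree
      exact le_rfl
    · simp only [eval₂_add, eval₂_mul, eval₂_pow, eval₂_X, eval₂_C, eval₂_sub, eval₂_one, hz]
      ring
  set S := integralClosure R N
  have : IsDiscreteValuationRing S := isDiscreteValuationRing_integralClosure R K N
  have : CharP S p := charP_integralClosure R K N
  have := finite_integralClosure R K N
  have := faithfulSMul_extension R K N
  obtain ⟨q, hq⟩ := IsDiscreteValuationRing.exists_irreducible S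
  have hgenS : Algebra.adjoin R {q} = ⊤ :=
    adjoin_uniformizer_eq_top (exists_sub_algebraMap_mem_maximalIdeal R K N) hq
  let z : S := ⟨y⁻¹, hzint⟩
  have hz0 : z ≠ 0 := fun h => inv_ne_zero hy0 (congrArg Subtype.val h)
  have hzS : z ^ p = algebraMap R S r * (1 - z ^ (p - 1)) := Subtype.ext hz
  have hvr : addVal S (algebraMap R S r) = (p * t : ℕ) := by
    have h1 : algebraMap R S r = (Units.map (algebraMap R S : R →* S) u⁻¹ : Sˣ) *
        algebraMap R S ϖ ^ t := by
      rw [hr, map_mul, map_pow]; rfl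
    rw [h1, addVal_mul, IsDiscreteValuationRing.addVal_eq_zero_of_unit, zero_add, addVal_pow,
      addVal_algebraMap_uniformizer R K N hϖ, hN, nsmul_eq_mul]
    push_cast
    ring
  have hvz : addVal S z = t := by
    obtain ⟨e, he⟩ := ENat.ne_top_iff_exists.1 (mt (addVal_eq_top_iff (a := z)).1 hz0)
    have h1 := congrArg (addVal S) hzS
    rw [addVal_mul, hvr, addVal_pow, ← he] at h1
    have he0 : e ≠ 0 := by
      rintro rfl
      simp only [CharP.cast_eq_zero, nsmul_zero] at h1
      have h2 := (add_eq_zero.1 h1.symm).1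
      have : p * t = 0 := by exact_mod_cast h2
      exact (mul_ne_zero hp1 ht0) this
    have hzm : z ∈ maximalIdeal S := by
      rw [mem_maximalIdeal, mem_nonunits_iff, ← addVal_eq_zero_iff, ← he]
      exact_mod_cast he0
    have hunit : IsUnit (1 - z ^ (p - 1)) := by
      by_contra hcon
      have h2 := Ideal.add_mem _ ((mem_maximalIdeal _).2 hcon)
        (Ideal.pow_mem_of_mem _ hzm _ (Nat.pos_of_ne_zero hp2))
      rw [sub_add_cancel] at h2
      exact (mem_maximalIdeal _).1 h2 isUnit_one
    rw [addVal_eq_zero_iff.2 hunit, add_zero, nsmul_eq_mul] at h1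
    have h3 : p * e = p * t := by exact_mod_cast h1
    rw [← he, Nat.eq_of_mul_eq_mul_left hp.pos h3]
  have hlow : ∀ σ : Gal(N/K), σ ≠ 1 → lowerNumber R K N σ = t := by
    intro σ hσ
    -- Since `w` is a nonzero root of `X ^ p - X`, it is a unit, and `σ z - z = -w z σ(z)` has
    -- valuation `2t`. By `addVal_sub_add_one_eq` this is `t + i(σ)`.
    set w : N := σ y - y with hw
    have hwp : w ^ p = w := by
      have h1 : σ y ^ p - σ y = algebraMap K N γ := by
        rw [← map_pow, ← map_sub, hy, AlgEquiv.commutes]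
      rw [hw, sub_pow_char]
      linear_combination h1 - hy
    have hw0 : w ≠ 0 := by
      intro h
      apply hσ
      have h1 : (σ : N →ₐ[K] N) = AlgHom.id K N := by
        have hy' := IntermediateField.adjoin_simple_toSubalgebra_of_isAlgebraic
          (Algebra.IsAlgebraic.isAlgebraic (R := K) y)
        rw [hgen, IntermediateField.top_toSubalgebra] at hy'
        refine AlgHom.ext_of_adjoin_eq_top hy'.symm ?_
        rintro _ rfl
        exact sub_eq_zero.1 h
      ext x
      exact DFunLike.congr_fun h1 x
    have hw1 : w ^ (p - 1) = 1 := by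
      apply mul_right_cancel₀ hw0
      rw [← pow_succ, hpp, hwp, one_mul]
    let ws : S := ⟨w, IsIntegral.of_pow (Nat.pos_of_ne_zero hp2) (hw1 ▸ isIntegral_one)⟩
    have hwsu : IsUnit ws := by
      have h1 : ws ^ (p - 1) = 1 := Subtype.ext hw1
      exact IsUnit.of_pow_eq_one h1 hp2
    have hdiff : galRestrict R K N S σ z - z = -(ws * (z * galRestrict R K N S σ z)) := by
      have h1 : ((galRestrict R K N S σ z : S) : N) = (σ y)⁻¹ := by
        have h2 := algebraMap_galRestrict_apply R (K := K) (L := N) (B := S) σ z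
        refine h2.trans ?_
        exact map_inv₀ σ y
      refine Subtype.ext ?_
      have h3 : σ y ≠ 0 := (map_ne_zero σ).2 hy0
      change ((galRestrict R K N S σ z : S) : N) - y⁻¹ =
        -(w * (y⁻¹ * ((galRestrict R K N S σ z : S) : N)))
      rw [h1, hw]
      field_simp
      ring
    have hp' : σ ^ p ^ 1 = 1 := by
      rw [pow_one, ← hN, ← IsGalois.card_aut_eq_finrank, pow_card_eq_one']
    have h4 := addVal_sub_add_one_eq (p := p) (galRestrict R K N S σ) hq hgenS
      (two_le_autDepth_galRestrict R K N hp') hvz hpt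
    have h5 : addVal S (galRestrict R K N S σ z) = t := by
      have := addVal_ringEquiv (galRestrict R K N S σ).toRingEquiv z
      exact this.trans hvz
    rw [hdiff, (addVal S).map_neg, addVal_mul, addVal_mul, addVal_eq_zero_iff.2 hwsu, h5, hvz,
      autDepth_galRestrict R K N hσ] at h4
    norm_cast at h4
    omega
  have hup : ∀ σ : Gal(N/K), σ ≠ 1 → upperNumber R K N σ = t := by
    intro σ hσ
    rw [upperNumber, hlow σ hσ]
    exact groupPhi_of_le _ fun s hs => by rw [hlow s hs]
  have hcard : 1 < Nat.card Gal(N/K) := by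
    rw [IsGalois.card_aut_eq_finrank, hN]; exact hp.one_lt
  have : Nontrivial Gal(N/K) := Finite.one_lt_card_iff_nontrivial.1 hcard
  obtain ⟨σ, hσ⟩ := exists_ne (1 : Gal(N/K))
  have hfin : -(ord R K γ : ℝ) = t := by rw [ht]; simp
  rw [upperJumps_eq_image, hfin]
  ext v
  constructor
  · rintro ⟨τ, hτ, rfl⟩
    exact hup τ hτ
  · rintro rfl
    exact ⟨σ, hσ, hup σ hσ⟩

end ArtinSchreier

end LocalRamification

namespace LocalRamification

open Polynomial

/-! ### Witt vectors of length two. -/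

section Witt

variable {p : ℕ} [Fact p.Prime]

/-- Functoriality of truncated Witt vectors. -/
noncomputable def truncatedWittMap {A B : Type*} [CommRing A] [CommRing B] (f : A →+* B) :
    TruncatedWittVector p 2 A →+* TruncatedWittVector p 2 B :=
  have key : ∀ X : WittVector p A,
      TruncatedWittVector.mk p (fun i => f ((WittVector.truncate 2 X).coeff i)) =
        WittVector.truncate 2 (WittVector.map f X) := fun X => by
    ext i
    simp [WittVector.map_coeff]
  { toFun := fun x => TruncatedWittVector.mk p fun i => f (x.coeff i)
    map_zero' := by
      have := key 0
      rwa [map_zero, map_zero, map_zero] at this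
    map_one' := by
      have := key 1
      rwa [map_one, map_one, map_one] at this
    map_add' := fun x y => by
      obtain ⟨X, rfl⟩ := WittVector.truncate_surjective p 2 A x
      obtain ⟨Y, rfl⟩ := WittVector.truncate_surjective p 2 A y
      rw [← map_add, key, key, key, map_add, map_add]
    map_mul' := fun x y => by
      obtain ⟨X, rfl⟩ := WittVector.truncate_surjective p 2 A x
      obtain ⟨Y, rfl⟩ := WittVector.truncate_surjective p 2 A y
      rw [← map_mul, key, key, key, map_mul, map_mul] }

@[simp] theorem truncatedWittMap_coeff {A B : Type*} [CommRing A] [CommRing B] (f : A →+* B)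
    (x : TruncatedWittVector p 2 A) (i : Fin 2) :
    (truncatedWittMap f x).coeff i = f (x.coeff i) := rfl

variable {A : Type*} [CommRing A]

variable (p) in
/-- The Teichmüller representative `(x, 0)`. -/
noncomputable def wittT (x : A) : TruncatedWittVector p 2 A :=
  WittVector.truncate 2 (WittVector.teichmuller p x)

variable (p) in
/-- The vector `(0, x)`. -/
noncomputable def wittV (x : A) : TruncatedWittVector p 2 A :=
  WittVector.truncate 2 (WittVector.verschiebung (WittVector.teichmuller p x))

omit [Fact p.Prime] [CommRing A] in
theorem truncatedWitt_ext {x y : TruncatedWittVector p 2 A} (h0 : x.coeff 0 = y.coeff 0)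
    (h1 : x.coeff 1 = y.coeff 1) : x = y := by
  ext i
  fin_cases i
  · exact h0
  · exact h1

@[simp] theorem wittT_coeff_zero (x : A) : (wittT p x).coeff 0 = x := by
  simp [wittT, WittVector.teichmuller_coeff_zero]

@[simp] theorem wittT_coeff_one (x : A) : (wittT p x).coeff 1 = 0 := by
  simp [wittT, WittVector.teichmuller_coeff_pos]

@[simp] theorem wittV_coeff_zero (x : A) : (wittV p x).coeff 0 = 0 := by
  simp [wittV, WittVector.verschiebung_coeff_zero]

@[simp] theorem wittV_coeff_one (x : A) : (wittV p x).coeff 1 = x := by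
  have h : (WittVector.verschiebung (WittVector.teichmuller p x)).coeff (0 + 1) = x := by
    rw [WittVector.verschiebung_coeff_succ, WittVector.teichmuller_coeff_zero]
  rw [wittV, WittVector.coeff_truncate]
  exact h

/-- In length two, `V X` depends only on the first coefficient of `X`; this transfers the identities
for `V` to `wittV`. -/
theorem wittV_truncate (X : WittVector p A) :
    WittVector.truncate 2 (WittVector.verschiebung X) = wittV p (X.coeff 0) := by
  refine truncatedWitt_ext ?_ ?_
  · simp [WittVector.verschiebung_coeff_zero]
  · have h : (WittVector.verschiebung X).coeff (0 + 1) = X.coeff 0 := by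
      rw [WittVector.verschiebung_coeff_succ]
    rw [WittVector.coeff_truncate, wittV_coeff_one]
    exact h

theorem wittV_add (x y : A) : wittV p (x + y) = wittV p x + wittV p y := by
  have h := wittV_truncate (WittVector.teichmuller p x + WittVector.teichmuller p y)
  rw [map_add, map_add, WittVector.add_coeff_zero, WittVector.teichmuller_coeff_zero,
    WittVector.teichmuller_coeff_zero] at h
  exact h.symm

theorem wittV_sub (x y : A) : wittV p (x - y) = wittV p x - wittV p y := by
  rw [eq_sub_iff_add_eq, ← wittV_add, sub_add_cancel]

theorem wittT_mul (x y : A) : wittT p (x * y) = wittT p x * wittT p y := by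
  simp [wittT]

/-- The projection formula `V(x F(c)) = V(x) c`, where `F` raises coefficients to the `p`-th power
in characteristic `p`. -/
theorem wittT_mul_wittV [CharP A p] (c x : A) : wittT p c * wittV p x = wittV p (c ^ p * x) := by
  have h := WittVector.verschiebung_mul_frobenius (WittVector.teichmuller p x)
    (WittVector.teichmuller p c)
  have h2 := congrArg (WittVector.truncate 2) h
  rw [wittV_truncate, map_mul, WittVector.mul_coeff_zero, WittVector.teichmuller_coeff_zero,
    WittVector.coeff_frobenius_charP, WittVector.teichmuller_coeff_zero, mul_comm x] at h2
  rw [h2, mul_comm]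
  rfl

/-- Witt vectors with disjoint supports add coefficientwise. This decomposition replaces the
explicit addition polynomials throughout. -/
theorem eq_wittT_add_wittV (x : TruncatedWittVector p 2 A) :
    x = wittT p (x.coeff 0) + wittV p (x.coeff 1) := by
  have hd : ∀ n, (WittVector.teichmuller p (x.coeff 0) +
      WittVector.verschiebung (WittVector.teichmuller p (x.coeff 1))).coeff n =
      (WittVector.teichmuller p (x.coeff 0)).coeff n +
      (WittVector.verschiebung (WittVector.teichmuller p (x.coeff 1))).coeff n := fun n => by
    refine WittVector.coeff_add_of_disjoint n _ _ fun m => ?_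
    rcases Nat.eq_zero_or_pos m with rfl | hm
    · right; exact WittVector.verschiebung_coeff_zero _
    · left; exact WittVector.teichmuller_coeff_pos p _ _ hm
  rw [wittT, wittV, ← map_add]
  refine truncatedWitt_ext ?_ ?_
  · have h1 := hd 0
    rw [WittVector.verschiebung_coeff_zero, WittVector.teichmuller_coeff_zero, add_zero] at h1
    rw [WittVector.coeff_truncate]
    exact h1.symm
  · have h1 := hd 1
    have h2 : (WittVector.verschiebung (WittVector.teichmuller p (x.coeff 1))).coeff (0 + 1) =
      x.coeff 1 := by
      rw [WittVector.verschiebung_coeff_succ, WittVector.teichmuller_coeff_zero]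
    rw [WittVector.teichmuller_coeff_pos p _ 1 one_pos, zero_add] at h1
    rw [zero_add] at h2
    rw [h2] at h1
    rw [WittVector.coeff_truncate]
    exact h1.symm

theorem truncatedWittMap_wittT {B : Type*} [CommRing B] (f : A →+* B) (x : A) :
    truncatedWittMap f (wittT p x) = wittT p (f x) := truncatedWitt_ext (by simp) (by simp)

theorem truncatedWittMap_wittV {B : Type*} [CommRing B] (f : A →+* B) (x : A) :
    truncatedWittMap f (wittV p x) = wittV p (f x) := truncatedWitt_ext (by simp) (by simp)

theorem truncatedWittMap_comp {B C : Type*} [CommRing B] [CommRing C] (f : A →+* B) (g : B →+* C)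
    (x : TruncatedWittVector p 2 A) :
    truncatedWittMap g (truncatedWittMap f x) = truncatedWittMap (g.comp f) x := rfl

theorem truncatedWittMap_frobenius_sub [CharP A p] (x : TruncatedWittVector p 2 A) :
    truncatedWittMap (frobenius A p) x - x =
      (wittT p (x.coeff 0 ^ p) - wittT p (x.coeff 0)) +
        wittV p (x.coeff 1 ^ p - x.coeff 1) := by
  conv_lhs => rw [eq_wittT_add_wittV x]
  rw [map_add, truncatedWittMap_wittT, truncatedWittMap_wittV, wittV_sub, frobenius_def,
    frobenius_def]
  ring

variable {K Ω : Type*} [Field K] [Field Ω] [Algebra K Ω]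

theorem IsASWGenerator.frobenius_sub [CharP Ω p] {α : TruncatedWittVector p 2 K}
    {a : TruncatedWittVector p 2 Ω} (h : IsASWGenerator α a) :
    truncatedWittMap (frobenius Ω p) a - a = truncatedWittMap (algebraMap K Ω) α := h.eq

theorem coeff_zero_sub (x y : TruncatedWittVector p 2 A) :
    (x - y).coeff 0 = x.coeff 0 - y.coeff 0 := by
  obtain ⟨X, rfl⟩ := WittVector.truncate_surjective p 2 A x
  obtain ⟨Y, rfl⟩ := WittVector.truncate_surjective p 2 A y
  rw [← map_sub, WittVector.coeff_truncate, WittVector.coeff_truncate, WittVector.coeff_truncate]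
  exact map_sub (WittVector.constantCoeff (p := p)) X Y

theorem coeff_zero_pow_sub [CharP Ω p] {α : TruncatedWittVector p 2 K}
    {a : TruncatedWittVector p 2 Ω}
    (h : truncatedWittMap (frobenius Ω p) a - a = truncatedWittMap (algebraMap K Ω) α) :
    a.coeff 0 ^ p - a.coeff 0 = algebraMap K Ω (α.coeff 0) := by
  have h1 := congrArg (TruncatedWittVector.coeff 0) h
  rwa [coeff_zero_sub] at h1

/-- If the first coordinate is in `K`, the Teichmüller part of `F a - a` comes from `W₂(K)`, and
what remains is an Artin–Schreier equation over `K` for the second one. -/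
theorem exists_coeff_one_pow_sub [CharP Ω p] {α : TruncatedWittVector p 2 K}
    {a : TruncatedWittVector p 2 Ω}
    (h : truncatedWittMap (frobenius Ω p) a - a = truncatedWittMap (algebraMap K Ω) α)
    {c : K} (hc : algebraMap K Ω c = a.coeff 0) :
    ∃ d : K, a.coeff 1 ^ p - a.coeff 1 = algebraMap K Ω d := by
  have h1 := truncatedWittMap_frobenius_sub a
  rw [h, ← hc, ← map_pow, ← truncatedWittMap_wittT, ← truncatedWittMap_wittT, ← map_sub,
    ← sub_eq_iff_eq_add', ← map_sub] at h1
  have h2 := congrArg (TruncatedWittVector.coeff 1) h1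
  rw [wittV_coeff_one] at h2
  exact ⟨_, h2.symm⟩

/-- Two solutions of Artin–Schreier–Witt equations with proportional first coordinates differ by
a solution of an Artin–Schreier equation. -/
theorem exists_eq_wittT_mul_add [CharP K p] [CharP Ω p] {α β : TruncatedWittVector p 2 K}
    {a b : TruncatedWittVector p 2 Ω}
    (ha : truncatedWittMap (frobenius Ω p) a - a = truncatedWittMap (algebraMap K Ω) α)
    (hb : truncatedWittMap (frobenius Ω p) b - b = truncatedWittMap (algebraMap K Ω) β)
    {c : K} (hcp : c ^ p = c) (h0 : α.coeff 0 = c * β.coeff 0) :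
    ∃ (e : K) (y : Ω), y ^ p - y = algebraMap K Ω (α.coeff 1 - c * β.coeff 1) ∧
      a = wittT p (algebraMap K Ω c) * b + wittT p (algebraMap K Ω e) + wittV p y := by
  -- As `F` fixes `[c]`, `F d - d = α - [c] β = (0, α₁ - c β₁)`. Hence the first coordinate of `d`
  -- lies in the prime field, and the second solves the equation for `y`.
  set d := a - wittT p (algebraMap K Ω c) * b with hd
  have hαβ : α - wittT p c * β = wittV p (α.coeff 1 - c * β.coeff 1) := by
    conv_lhs => rw [eq_wittT_add_wittV α, eq_wittT_add_wittV β]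
    rw [mul_add, ← wittT_mul, wittT_mul_wittV, hcp, h0, wittV_sub]
    ring
  have hφd : truncatedWittMap (frobenius Ω p) d - d =
      wittV p (algebraMap K Ω (α.coeff 1 - c * β.coeff 1)) := by
    have h1 : truncatedWittMap (frobenius Ω p) (wittT p (algebraMap K Ω c)) =
        wittT p (algebraMap K Ω c) := by
      rw [truncatedWittMap_wittT, frobenius_def, ← map_pow, hcp]
    have h2 : truncatedWittMap (frobenius Ω p) d - d =
        (truncatedWittMap (frobenius Ω p) a - a) -
          wittT p (algebraMap K Ω c) * (truncatedWittMap (frobenius Ω p) b - b) := by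
      rw [hd, map_sub, map_mul, h1]
      ring
    rw [h2, ha, hb, ← truncatedWittMap_wittV, ← hαβ, map_sub, map_mul, truncatedWittMap_wittT]
  have hd0 : d.coeff 0 ^ p = d.coeff 0 := by
    have h1 := congrArg (TruncatedWittVector.coeff 0) hφd
    rw [coeff_zero_sub, wittV_coeff_zero] at h1
    exact sub_eq_zero.1 h1
  have hd1 := truncatedWittMap_frobenius_sub d
  rw [hφd, hd0, sub_self, zero_add] at hd1
  obtain ⟨e, he⟩ : ∃ e : K, algebraMap K Ω e = d.coeff 0 := by
    have h1 := (Subfield.mem_bot_iff_pow_eq_self Ω p).2 hd0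
    have h2 : (⊥ : Subfield Ω) ≤ (algebraMap K Ω).fieldRange := bot_le
    exact h2 h1
  refine ⟨e, d.coeff 1, ?_, ?_⟩
  · have h1 := congrArg (TruncatedWittVector.coeff 1) hd1
    rw [wittV_coeff_one, wittV_coeff_one] at h1
    exact h1.symm
  · rw [he, add_assoc, ← eq_wittT_add_wittV d, hd]
    ring

end Witt

end LocalRamification

namespace LocalRamification

open Polynomial

/-! ### Abelian groups of order `p ^ 3`. -/

section GroupTheory

theorem card_eq_card_ker_mul_card {G Q : Type*} [Group G] [Group Q] (π : G →* Q)
    (hπ : Function.Surjective π) : Nat.card G = Nat.card π.ker * Nat.card Q := by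
  rw [← π.ker.card_mul_index, Subgroup.index_ker, MonoidHom.range_eq_top.2 hπ, Subgroup.card_top]

/-- A commutative group of order `p ^ 3` and exponent dividing `p ^ 2` which surjects onto a cyclic
group of order `p ^ 2`. -/
theorem nonempty_mulEquiv_zmod_prod {p : ℕ} [Fact p.Prime] {G Q : Type*} [Group G] [Group Q]
    [Finite G] [Finite Q] [IsCyclic Q] (hcomm : ∀ a b : G, a * b = b * a) (π : G →* Q)
    (hπ : Function.Surjective π) (hQ : Nat.card Q = p ^ 2) (hG : Nat.card G = p ^ 3)
    (hexp : ∀ g : G, g ^ p ^ 2 = 1) :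
    Nonempty (G ≃* Multiplicative (ZMod (p ^ 2) × ZMod p)) := by
  have hp : p.Prime := Fact.out
  let : CommGroup G := { (inferInstance : Group G) with mul_comm := hcomm }
  have hker : Nat.card π.ker = p := by
    have h := card_eq_card_ker_mul_card π hπ
    rw [hG, hQ] at h
    have h2 : p ^ 2 * p = p ^ 2 * Nat.card π.ker := by rw [mul_comm _ (Nat.card _), ← h]; ring
    exact (Nat.eq_of_mul_eq_mul_left (pow_pos hp.pos 2) h2).symm
  obtain ⟨q, hq⟩ := IsCyclic.exists_generator (α := Q)
  have hqord : orderOf q = p ^ 2 := by rw [orderOf_eq_card_of_forall_mem_zpowers hq, hQ]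
  obtain ⟨s, rfl⟩ := hπ q
  have : IsCyclic π.ker := isCyclic_of_prime_card hker
  obtain ⟨n, hn⟩ := IsCyclic.exists_generator (α := π.ker)
  have hnord : orderOf (n : G) = p := by
    rw [Subgroup.orderOf_coe, orderOf_eq_card_of_forall_mem_zpowers hn, hker]
  let f₁ : ZMod (p ^ 2) →+ Additive G := ZMod.lift (p ^ 2)
    ⟨zmultiplesHom (Additive G) (Additive.ofMul s), by
      simp only [zmultiplesHom_apply, natCast_zsmul, ← ofMul_pow, hexp, ofMul_one]⟩
  let f₂ : ZMod p →+ Additive G := ZMod.lift p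
    ⟨zmultiplesHom (Additive G) (Additive.ofMul (n : G)), by
      simp only [zmultiplesHom_apply, natCast_zsmul, ← ofMul_pow]
      rw [← hnord, pow_orderOf_eq_one, ofMul_one]⟩
  have hf₁ : ∀ k : ℤ, f₁ k = Additive.ofMul (s ^ k) := fun k => by
    simp only [f₁, ZMod.lift_coe, zmultiplesHom_apply, ofMul_zpow]
  have hf₂ : ∀ k : ℤ, f₂ k = Additive.ofMul ((n : G) ^ k) := fun k => by
    simp only [f₂, ZMod.lift_coe, zmultiplesHom_apply, ofMul_zpow]
  let f : ZMod (p ^ 2) × ZMod p →+ Additive G := f₁.coprod f₂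
  -- Applying `π` to `s ^ a * n ^ b = 1` gives `p ^ 2 ∣ a`; then `s ^ a = 1` by the exponent bound,
  -- and `p ∣ b`.
  have hinj : Function.Injective f := by
    rw [injective_iff_map_eq_zero]
    rintro ⟨a, b⟩ hab
    obtain ⟨a, rfl⟩ := ZMod.intCast_surjective a
    obtain ⟨b, rfl⟩ := ZMod.intCast_surjective b
    have h1 : s ^ a * (n : G) ^ b = 1 := by
      have h2 : f₁ a + f₂ b = 0 := hab
      rw [hf₁, hf₂, ← ofMul_mul] at h2
      exact h2
    have h3 : π s ^ a = 1 := by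
      have h4 := congrArg π h1
      have h5 : π (n : G) = 1 := n.2
      simpa [h5] using h4
    have h6 : ((p ^ 2 : ℕ) : ℤ) ∣ a := by
      rw [← hqord]; exact orderOf_dvd_iff_zpow_eq_one.2 h3
    have h7 : s ^ a = 1 := by
      obtain ⟨k, rfl⟩ := h6
      rw [zpow_mul, zpow_natCast, hexp, one_zpow]
    rw [h7, one_mul] at h1
    have h8 : ((p : ℕ) : ℤ) ∣ b := by
      rw [← hnord]; exact orderOf_dvd_iff_zpow_eq_one.2 h1
    exact Prod.ext ((ZMod.intCast_zmod_eq_zero_iff_dvd _ _).2 h6)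
      ((ZMod.intCast_zmod_eq_zero_iff_dvd _ _).2 h8)
  have : NeZero (p ^ 2) := ⟨(pow_pos hp.pos 2).ne'⟩
  have hbij : Function.Bijective f := by
    refine (Nat.bijective_iff_injective_and_card f).2 ⟨hinj, ?_⟩
    rw [Nat.card_prod, Nat.card_zmod, Nat.card_zmod]
    change _ = Nat.card G
    rw [hG]; ring
  exact ⟨(AddEquiv.toMultiplicative (AddEquiv.ofBijective f hbij)).symm⟩

end GroupTheory

/-! ### Restriction of automorphisms and subfields of degree `p`. -/

section FieldTheory

variable {K Ω : Type*} [Field K] [Field Ω] [Algebra K Ω]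

theorem exists_surjective_restrict {F E : IntermediateField K Ω} (h : F ≤ E) [Normal K F]
    [Normal K E] : ∃ π : Gal(E/K) →* Gal(F/K), Function.Surjective π ∧
      ∀ (σ : Gal(E/K)) (x : F), ((π σ x : F) : Ω) = σ (IntermediateField.inclusion h x) := by
  let : Algebra F E := (IntermediateField.inclusion h).toRingHom.toAlgebra
  have : IsScalarTower K F E := .of_algebraMap_eq fun _ => rfl
  exact ⟨AlgEquiv.restrictNormalHom F, AlgEquiv.restrictNormalHom_surjective E, fun σ x =>
    congrArg Subtype.val (AlgEquiv.restrictNormal_commutes σ F x)⟩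

theorem eq_one_of_restrict_eq_one {L M : IntermediateField K Ω} {σ : Gal(↥(L ⊔ M)/K)}
    (hL : ∀ x : L, σ (IntermediateField.inclusion le_sup_left x) =
      IntermediateField.inclusion le_sup_left x)
    (hM : ∀ x : M, σ (IntermediateField.inclusion le_sup_right x) =
      IntermediateField.inclusion le_sup_right x) : σ = 1 := by
  have h : (σ : ↥(L ⊔ M) →ₐ[K] ↥(L ⊔ M)) = AlgHom.id K _ := by
    refine IntermediateField.algHom_ext_of_eq_adjoin _ (IntermediateField.sup_def L M) ?_
    rintro x (hx | hx)
    · exact hL ⟨x, hx⟩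
    · exact hM ⟨x, hx⟩
  ext x
  exact congrArg Subtype.val (DFunLike.congr_fun h x)

theorem eq_of_finrank_eq_of_isCyclic {E : Type*} [Field E] [Algebra K E] [FiniteDimensional K E]
    [IsGalois K E] [IsCyclic Gal(E/K)] {F F' : IntermediateField K E}
    (h : Module.finrank K F = Module.finrank K F') : F = F' := by
  have h1 := Module.finrank_mul_finrank K F E
  rw [← Module.finrank_mul_finrank K F' E, h] at h1
  have h2 := Nat.eq_of_mul_eq_mul_left Module.finrank_pos h1
  rw [← IsGalois.card_fixingSubgroup_eq_finrank, ← IsGalois.card_fixingSubgroup_eq_finrank] at h2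
  rw [← IsGalois.fixedField_fixingSubgroup F, ← IsGalois.fixedField_fixingSubgroup F',
    eq_of_card_eq_of_isCyclic h2]

/-- Over a field extension of `p`-power degree, a root of an Artin–Schreier polynomial which does
not lie in the base field has degree `p`. -/
theorem finrank_adjoin_artinSchreier {p n : ℕ} (hp : p.Prime) {E : Type*} [Field E] [Algebra K E]
    (hE : Module.finrank K E = p ^ n) {x : E} {c : K} (hx : x ^ p - x = algebraMap K E c)
    (hxK : x ∉ (⊥ : IntermediateField K E)) :
    Module.finrank K (IntermediateField.adjoin K {x}) = p := by
  have : FiniteDimensional K E := .of_finrank_pos (hE ▸ pow_pos hp.pos n)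
  have hle : Module.finrank K (IntermediateField.adjoin K {x}) ≤ p := by
    rw [IntermediateField.adjoin.finrank (IsIntegral.of_finite K x)]
    have hdeg : (-X - C c : K[X]).degree < p := by
      refine lt_of_le_of_lt (b := (1 : WithBot ℕ)) ?_ (by exact_mod_cast hp.one_lt)
      compute_degree!
    have hmonic : (X ^ p + (-X - C c) : K[X]).Monic := monic_X_pow_add hdeg
    have hroot : aeval x (X ^ p + (-X - C c) : K[X]) = 0 := by
      simp only [map_add, map_sub, map_neg, map_pow, aeval_X, aeval_C]
      linear_combination hx
    refine (natDegree_le_of_dvd (minpoly.dvd K x hroot) hmonic.ne_zero).trans ?_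
    rw [natDegree_add_eq_left_of_degree_lt (by rwa [degree_X_pow]), natDegree_X_pow]
  have hdvd : Module.finrank K (IntermediateField.adjoin K {x}) ∣ p ^ n := by
    rw [← hE]
    exact Module.finrank_dvd_finrank_right K _ E
  obtain ⟨k, -, hk⟩ := (Nat.dvd_prime_pow hp).1 hdvd
  have hk0 : k ≠ 0 := by
    rintro rfl
    rw [pow_zero, IntermediateField.finrank_adjoin_simple_eq_one_iff] at hk
    exact hxK hk
  have hk1 : k = 1 := by
    by_contra hk1
    have h2 : p ^ 2 ≤ p ^ k := Nat.pow_le_pow_right hp.pos (by omega)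
    rw [← hk] at h2
    have := hp.two_le
    nlinarith
  rw [hk, hk1, pow_one]

end FieldTheory

/-! ### Jumps for nested intermediate fields. -/

section Tower

variable {R : Type*} [CommRing R] [IsDomain R] [IsDiscreteValuationRing R]
  [IsAdicComplete (IsLocalRing.maximalIdeal R) R] [IsAlgClosed (IsLocalRing.ResidueField R)]
  {K : Type*} [Field K] [Algebra R K] [IsFractionRing R K]
  {Ω : Type*} [Field Ω] [Algebra K Ω] [Algebra R Ω] [IsScalarTower R K Ω]

theorem upperJumps_subset_of_le {F E : IntermediateField K Ω} (h : F ≤ E) [FiniteDimensional K F]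
    [IsGalois K F] [FiniteDimensional K E] [IsGalois K E] :
    upperJumps R K F ⊆ upperJumps R K E := by
  let : Algebra F E := (IntermediateField.inclusion h).toRingHom.toAlgebra
  have : IsScalarTower K F E := .of_algebraMap_eq fun _ => rfl
  exact upperJumps_subset R K E F

theorem exists_upperJumps_eq_pair_of_le {p : ℕ} [Fact p.Prime] [CharP K p]
    {F E : IntermediateField K Ω} (h : F ≤ E) [FiniteDimensional K F]
    [IsGalois K F] [FiniteDimensional K E] [IsGalois K E] [IsCyclic Gal(E/K)]
    (hE : Module.finrank K E = p ^ 2) (hF : Module.finrank K F = p) :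
    ∃ u₀ u₁ : ℝ, u₀ < u₁ ∧ upperJumps R K E = {u₀, u₁} ∧ upperJumps R K F = {u₀} := by
  let : Algebra F E := (IntermediateField.inclusion h).toRingHom.toAlgebra
  have : IsScalarTower K F E := .of_algebraMap_eq fun _ => rfl
  exact exists_upperJumps_eq_pair R K E F hE hF

end Tower

end LocalRamification

namespace LocalRamification

/-! ### The compositum, its Galois group and its Artin–Schreier element. -/

section Compositum

variable {p : ℕ} [Fact p.Prime] {K Ω : Type*} [Field K] [Field Ω] [Algebra K Ω]
  {L M : IntermediateField K Ω}

omit [Fact p.Prime] in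
theorem IsCyclicExtension.finiteDimensional {E : Type*} [Field E] [Algebra K E] {n : ℕ}
    (h : IsCyclicExtension K E n) (hn : 0 < n) : FiniteDimensional K E :=
  .of_finrank_pos (h.finrank_eq ▸ hn)

/-- The degree of `L ∩ M` divides `p ^ 2`. Degree `1` would make the Galois extensions `L` and `M`
linearly disjoint, degree `p ^ 2` would make them equal. -/
theorem isCyclicExtension_inf (hL : IsCyclicExtension K L (p ^ 2))
    (hM : IsCyclicExtension K M (p ^ 2)) (hne : L ≠ M) (hld : ¬ L.LinearDisjoint M) :
    IsCyclicExtension K ↥(L ⊓ M) p := by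
  have hp : p.Prime := Fact.out
  have := hL.isGalois
  have := hM.isGalois
  have := hL.finiteDimensional (pow_pos hp.pos 2)
  have := hM.finiteDimensional (pow_pos hp.pos 2)
  have hdvd : Module.finrank K ↥(L ⊓ M) ∣ p ^ 2 :=
    hL.finrank_eq ▸ IntermediateField.finrank_dvd_of_le_right inf_le_left
  obtain ⟨k, hk2, hk⟩ := (Nat.dvd_prime_pow hp).1 hdvd
  have hk0 : k ≠ 0 := by
    rintro rfl
    exact hld (.of_inf_eq_bot (IntermediateField.finrank_eq_one_iff.1 (by simpa using hk)))
  have hk2' : k ≠ 2 := by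
    rintro rfl
    have h1 := IntermediateField.eq_of_le_of_finrank_eq (inf_le_left : L ⊓ M ≤ L)
      (hk.trans hL.finrank_eq.symm)
    have h2 := IntermediateField.eq_of_le_of_finrank_eq (inf_le_right : L ⊓ M ≤ M)
      (hk.trans hM.finrank_eq.symm)
    exact hne (h1.symm.trans h2)
  obtain rfl : k = 1 := by omega
  rw [pow_one] at hk
  have : IsGalois K ↥(L ⊓ M) := ⟨⟩
  exact ⟨inferInstance, isCyclic_of_prime_card (p := p) (by rw [IsGalois.card_aut_eq_finrank, hk]),
    hk⟩

theorem exists_restrict_prod (L M : IntermediateField K Ω) [Normal K L] [Normal K M] :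
    ∃ (π : Gal(↥(L ⊔ M)/K) →* Gal(L/K)) (ρ : Gal(↥(L ⊔ M)/K) →* Gal(M/K)),
      Function.Surjective π ∧ (∀ σ, π σ = 1 → ρ σ = 1 → σ = 1) ∧
      ∀ σ (x : ↥(L ⊓ M)), ((π σ (IntermediateField.inclusion inf_le_left x) : L) : Ω) =
        (ρ σ (IntermediateField.inclusion inf_le_right x) : M) := by
  obtain ⟨π, hπ, hπ'⟩ := exists_surjective_restrict (le_sup_left : L ≤ L ⊔ M)
  obtain ⟨ρ, -, hρ'⟩ := exists_surjective_restrict (le_sup_right : M ≤ L ⊔ M)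
  refine ⟨π, ρ, hπ, fun σ h1 h2 => eq_one_of_restrict_eq_one (fun x => ?_) fun x => ?_,
    fun σ x => ?_⟩
  · have h := hπ' σ x
    rw [h1] at h
    exact Subtype.ext h.symm
  · have h := hρ' σ x
    rw [h2] at h
    exact Subtype.ext h.symm
  · rw [hπ', hρ']
    rfl

theorem isAbelianGalois_sup [IsAbelianGalois K L] [IsAbelianGalois K M] :
    IsAbelianGalois K ↥(L ⊔ M) := by
  obtain ⟨π, ρ, -, h, -⟩ := exists_restrict_prod L M
  have hG : IsGalois K ↥(L ⊔ M) := inferInstance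
  refine { hG with is_comm := ⟨fun σ τ => ?_⟩ }
  rw [← mul_inv_eq_one]
  refine h _ ?_ ?_
  · rw [map_mul, map_inv, map_mul, map_mul, mul_inv_eq_one]
    exact IsMulCommutative.is_comm.comm _ _
  · rw [map_mul, map_inv, map_mul, map_mul, mul_inv_eq_one]
    exact IsMulCommutative.is_comm.comm _ _

/-- The kernel of restriction to `L` embeds into the automorphisms of `M` trivial on `L ∩ M`, a
group of order `p`. It is not trivial, since otherwise `L = LM = M`. -/
theorem card_aut_sup (hL : IsCyclicExtension K L (p ^ 2)) (hM : IsCyclicExtension K M (p ^ 2))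
    (hne : L ≠ M) (hld : ¬ L.LinearDisjoint M) : Nat.card Gal(↥(L ⊔ M)/K) = p ^ 3 := by
  have hp : p.Prime := Fact.out
  have := hL.isGalois
  have := hM.isGalois
  have := hL.finiteDimensional (pow_pos hp.pos 2)
  have := hM.finiteDimensional (pow_pos hp.pos 2)
  have hN := isCyclicExtension_inf hL hM hne hld
  have := hN.isGalois
  obtain ⟨π, ρ, hπ, hinj, hπρ⟩ := exists_restrict_prod L M
  obtain ⟨θ, hθ, hθ'⟩ := exists_surjective_restrict (inf_le_right : L ⊓ M ≤ M)
  have hcard := card_eq_card_ker_mul_card π hπ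
  rw [IsGalois.card_aut_eq_finrank K L, hL.finrank_eq] at hcard
  have hker : Nat.card θ.ker = p := by
    have h := card_eq_card_ker_mul_card θ hθ
    rw [IsGalois.card_aut_eq_finrank, IsGalois.card_aut_eq_finrank, hM.finrank_eq,
      hN.finrank_eq, sq] at h
    exact (Nat.eq_of_mul_eq_mul_right hp.pos h).symm
  have hmem : ∀ σ : π.ker, ρ σ ∈ θ.ker := fun σ => by
    rw [MonoidHom.mem_ker]
    ext x
    rw [hθ', ← hπρ, (MonoidHom.mem_ker).1 σ.2]
    rfl
  have hdvd : Nat.card π.ker ∣ p := by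
    rw [← hker]
    refine Subgroup.card_dvd_of_injective ((ρ.comp π.ker.subtype).codRestrict θ.ker hmem) ?_
    rw [injective_iff_map_eq_one]
    intro σ hσ
    exact Subtype.ext (hinj σ σ.2 (congrArg Subtype.val hσ))
  rcases (Nat.dvd_prime hp).1 hdvd with h | h
  · rw [h, one_mul, IsGalois.card_aut_eq_finrank] at hcard
    have h1 := IntermediateField.eq_of_le_of_finrank_eq (le_sup_left : L ≤ L ⊔ M)
      (hL.finrank_eq.trans hcard.symm)
    have h2 := IntermediateField.eq_of_le_of_finrank_eq (le_sup_right : M ≤ L ⊔ M)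
      (hM.finrank_eq.trans hcard.symm)
    exact absurd (h1.trans h2.symm) hne
  · rw [hcard, h]
    ring

theorem nonempty_aut_sup_mulEquiv (hL : IsCyclicExtension K L (p ^ 2))
    (hM : IsCyclicExtension K M (p ^ 2)) (hne : L ≠ M) (hld : ¬ L.LinearDisjoint M) :
    Nonempty (Gal(↥(L ⊔ M)/K) ≃* Multiplicative (ZMod (p ^ 2) × ZMod p)) := by
  have hp : p.Prime := Fact.out
  have := hL.isGalois
  have := hM.isGalois
  have := hL.isCyclic
  have := hM.isCyclic
  have := hL.finiteDimensional (pow_pos hp.pos 2)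
  have := hM.finiteDimensional (pow_pos hp.pos 2)
  have : IsAbelianGalois K L := .of_isCyclic K L
  have : IsAbelianGalois K M := .of_isCyclic K M
  have : IsAbelianGalois K ↥(L ⊔ M) := isAbelianGalois_sup
  obtain ⟨π, ρ, hπ, hinj, -⟩ := exists_restrict_prod L M
  have hcL : Nat.card Gal(L/K) = p ^ 2 := by rw [IsGalois.card_aut_eq_finrank, hL.finrank_eq]
  have hcM : Nat.card Gal(M/K) = p ^ 2 := by rw [IsGalois.card_aut_eq_finrank, hM.finrank_eq]
  refine nonempty_mulEquiv_zmod_prod (fun a b => IsMulCommutative.is_comm.comm a b) π hπ hcL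
    (card_aut_sup hL hM hne hld) fun g => hinj _ ?_ ?_
  · rw [map_pow, ← hcL, pow_card_eq_one']
  · rw [map_pow, ← hcM, pow_card_eq_one']

/-- A cyclic extension has one subfield of degree `p`, so only `a₀ ∉ K` is at stake. If `a₀ ∈ K`,
then `L = K(a₁)` with `a₁` a root of an Artin–Schreier polynomial over `K`, of degree at most `p`.
-/
theorem inf_eq_adjoin_coeff_zero [CharP K p] {F : IntermediateField K Ω}
    (hL : IsCyclicExtension K L (p ^ 2)) (hFL : F ≤ L) (hF : Module.finrank K F = p)
    {α : TruncatedWittVector p 2 K} {a : TruncatedWittVector p 2 L} (ha : IsASWGenerator α a) :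
    F = IntermediateField.adjoin K {((a.coeff 0 : L) : Ω)} := by
  have hp : p.Prime := Fact.out
  have := hL.isGalois
  have := hL.isCyclic
  have := hL.finiteDimensional (pow_pos hp.pos 2)
  have : CharP L p := charP_of_injective_algebraMap (algebraMap K L).injective p
  have h := ha.frobenius_sub
  have hnot : a.coeff 0 ∉ (⊥ : IntermediateField K L) := by
    intro h0
    obtain ⟨c, hc⟩ := IntermediateField.mem_bot.1 h0
    obtain ⟨d, hd⟩ := exists_coeff_one_pow_sub h hc
    have htop : IntermediateField.adjoin K {a.coeff 1} = ⊤ := by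
      rw [eq_top_iff, ← ha.adjoin_eq_top, IntermediateField.adjoin_le_iff]
      rintro x (rfl | rfl)
      · exact (bot_le : ⊥ ≤ IntermediateField.adjoin K {a.coeff 1}) h0
      · exact IntermediateField.mem_adjoin_simple_self K _
    have hcard : Module.finrank K (IntermediateField.adjoin K {a.coeff 1}) = p ^ 2 := by
      rw [htop, IntermediateField.finrank_top', hL.finrank_eq]
    have hlt : 1 < p := hp.one_lt
    by_cases h1 : a.coeff 1 ∈ (⊥ : IntermediateField K L)
    · rw [IntermediateField.finrank_adjoin_simple_eq_one_iff.2 h1] at hcard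
      nlinarith
    · rw [finrank_adjoin_artinSchreier hp hL.finrank_eq hd h1] at hcard
      nlinarith
  have h1 := finrank_adjoin_artinSchreier hp hL.finrank_eq (coeff_zero_pow_sub h) hnot
  have h2 : Module.finrank K (IntermediateField.restrict hFL) = p := by
    rw [← (IntermediateField.restrictAlgEquiv hFL).toLinearEquiv.finrank_eq, hF]
  have h3 := congrArg IntermediateField.lift (eq_of_finrank_eq_of_isCyclic (h2.trans h1.symm))
  rwa [IntermediateField.lift_restrict, IntermediateField.lift_adjoin_simple] at h3

/-- The `W₂(Ω)`-valued generator attached to an extension inside `Ω`. -/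
theorem IsASWGenerator.frobenius_sub_val [CharP Ω p] {α : TruncatedWittVector p 2 K}
    {a : TruncatedWittVector p 2 L} (ha : IsASWGenerator α a) :
    truncatedWittMap (frobenius Ω p) (truncatedWittMap L.val.toRingHom a) -
      truncatedWittMap L.val.toRingHom a = truncatedWittMap (algebraMap K Ω) α := by
  have : CharP L p :=
    (RingHom.charP_iff (algebraMap L Ω) (algebraMap L Ω).injective p).2 inferInstance
  have h := congrArg (truncatedWittMap L.val.toRingHom) ha.frobenius_sub
  rw [map_sub, truncatedWittMap_comp, truncatedWittMap_comp] at h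
  rw [truncatedWittMap_comp]
  have h1 : L.val.toRingHom.comp (frobenius L p) = (frobenius Ω p).comp L.val.toRingHom :=
    RingHom.ext fun x => map_pow L.val x p
  have h2 : L.val.toRingHom.comp (algebraMap K L) = algebraMap K Ω := rfl
  rwa [h1, h2] at h

theorem coeff_mem_of_mem_range {x : TruncatedWittVector p 2 Ω}
    (hx : x ∈ (truncatedWittMap (p := p) L.val.toRingHom).range) (i : Fin 2) : x.coeff i ∈ L := by
  obtain ⟨y, rfl⟩ := hx
  exact (y.coeff i).2

theorem wittT_mem_range (e : K) :
    wittT p (algebraMap K Ω e) ∈ (truncatedWittMap (p := p) L.val.toRingHom).range :=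
  ⟨wittT p (algebraMap K L e), truncatedWittMap_wittT _ _⟩

theorem wittV_mem_range {y : Ω} (hy : y ∈ L) :
    wittV p y ∈ (truncatedWittMap (p := p) L.val.toRingHom).range :=
  ⟨wittV p (⟨y, hy⟩ : L), truncatedWittMap_wittV _ _⟩

theorem truncatedWittMap_val_mem_range (h : L ≤ M) (a : TruncatedWittVector p 2 L) :
    truncatedWittMap L.val.toRingHom a ∈ (truncatedWittMap (p := p) M.val.toRingHom).range :=
  ⟨truncatedWittMap (IntermediateField.inclusion h).toRingHom a, rfl⟩

/-- The Artin–Schreier generator of the compositum of two Artin–Schreier–Witt extensions whose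
Witt vectors have proportional first coordinates. -/
theorem exists_artinSchreier_mem_sup [CharP K p] {α β : TruncatedWittVector p 2 K}
    {a : TruncatedWittVector p 2 L} {b : TruncatedWittVector p 2 M} (ha : IsASWGenerator α a)
    (hb : IsASWGenerator β b) {c : K} (hcp : c ^ p = c) (h0 : α.coeff 0 = c * β.coeff 0)
    (hLM : ¬ L ≤ M) :
    ∃ y ∈ L ⊔ M, y ^ p - y = algebraMap K Ω (α.coeff 1 - c * β.coeff 1) ∧
      y ∉ (⊥ : IntermediateField K Ω) := by
  have : CharP Ω p := charP_of_injective_algebraMap (algebraMap K Ω).injective p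
  obtain ⟨e, y, hy, hay⟩ :=
    exists_eq_wittT_mul_add ha.frobenius_sub_val hb.frobenius_sub_val hcp h0
  refine ⟨y, ?_, hy, fun hyK => hLM ?_⟩
  · have h : wittV p y ∈ (truncatedWittMap (p := p) (L ⊔ M).val.toRingHom).range := by
      rw [eq_sub_iff_add_eq'.2 hay.symm]
      exact sub_mem (truncatedWittMap_val_mem_range le_sup_left a)
        (add_mem (mul_mem (wittT_mem_range c) (truncatedWittMap_val_mem_range le_sup_right b))
          (wittT_mem_range e))
    simpa using coeff_mem_of_mem_range h 1
  -- If `y ∈ K`, then `a = [c] b + [e] + (0, y)` has coordinates in `M`, and they generate `L`.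
  · have h : truncatedWittMap L.val.toRingHom a ∈
        (truncatedWittMap (p := p) M.val.toRingHom).range := by
      rw [hay]
      exact add_mem (add_mem (mul_mem (wittT_mem_range c)
        (truncatedWittMap_val_mem_range le_rfl b)) (wittT_mem_range e))
        (wittV_mem_range ((bot_le : ⊥ ≤ M) hyK))
    have h1 := congrArg IntermediateField.lift ha.adjoin_eq_top
    rw [IntermediateField.lift_adjoin, IntermediateField.lift_top] at h1
    rw [← h1, IntermediateField.adjoin_le_iff]
    rintro _ ⟨x, rfl | rfl, rfl⟩
    · exact coeff_mem_of_mem_range h 0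
    · exact coeff_mem_of_mem_range h 1

end Compositum

/-! ### Artin–Schreier elements produce jumps. -/

section Jump

variable {R : Type*} [CommRing R] [IsDomain R] [IsDiscreteValuationRing R]
  [IsAdicComplete (IsLocalRing.maximalIdeal R) R] [IsAlgClosed (IsLocalRing.ResidueField R)]
  {K : Type*} [Field K] [Algebra R K] [IsFractionRing R K]

/-- An Artin–Schreier element of an abelian extension of `p`-power degree gives an upper jump. -/
theorem neg_ord_mem_upperJumps {p n : ℕ} [Fact p.Prime] [CharP K p] {E : Type*} [Field E]
    [Algebra K E] [Algebra R E] [IsScalarTower R K E] [FiniteDimensional K E] [IsAbelianGalois K E]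
    (hE : Module.finrank K E = p ^ n) {y : E} {γ : K} (hy : y ^ p - y = algebraMap K E γ)
    (hyK : y ∉ (⊥ : IntermediateField K E)) (hγ : ¬ (p : ℤ) ∣ ord R K γ) :
    -(ord R K γ : ℝ) ∈ upperJumps R K E := by
  have hp : p.Prime := Fact.out
  have : CharP E p := charP_of_injective_algebraMap (algebraMap K E).injective p
  -- Valuation `0`, which includes `γ = 0` by the default value of `ord`, is divisible by `p`. If it
  -- were positive, `γ = x ^ p - x` with `x ∈ K`, and `y - x` would lie in the prime field.
  have hneg : ord R K γ < 0 := by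
    have hne : ord R K γ ≠ 0 := fun h => hγ (h ▸ dvd_zero _)
    refine lt_of_le_of_ne (not_lt.1 fun hpos => hyK ?_) hne
    obtain ⟨x, hx⟩ := exists_pow_sub_self_eq hpos
    have h1 : (y - algebraMap K E x) ^ p = y - algebraMap K E x := by
      rw [sub_pow_char, ← map_pow]
      have h2 := congrArg (algebraMap K E) hx
      rw [map_sub] at h2
      linear_combination hy - h2
    have h2 : y - algebraMap K E x ∈ (algebraMap K E).fieldRange :=
      (bot_le : (⊥ : Subfield E) ≤ _) ((Subfield.mem_bot_iff_pow_eq_self E p).2 h1)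
    obtain ⟨z, hz⟩ := h2
    exact IntermediateField.mem_bot.2 ⟨z + x, by rw [map_add, hz, sub_add_cancel]⟩
  let N := IntermediateField.adjoin K {y}
  let g : N := IntermediateField.AdjoinSimple.gen K y
  have hg : g ^ p - g = algebraMap K N γ := Subtype.ext hy
  have hgen : IntermediateField.adjoin K {g} = ⊤ := by
    refine IntermediateField.lift_injective N ?_
    rw [IntermediateField.lift_adjoin_simple, IntermediateField.lift_top]
    rfl
  have h := upperJumps_artinSchreier (R := R) (finrank_adjoin_artinSchreier hp hE hy hyK) hg hgen
    hneg hγ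
  refine upperJumps_subset R K E N ?_
  rw [h]
  rfl

end Jump

end LocalRamification

/-! ### The jumps of the compositum. -/

theorem mainTheorem4 {p : ℕ} [Fact p.Prime]
    {R : Type*} [CommRing R] [IsDomain R] [IsDiscreteValuationRing R]
    [IsAdicComplete (IsLocalRing.maximalIdeal R) R]
    [IsAlgClosed (IsLocalRing.ResidueField R)]
    {K : Type*} [Field K] [CharP K p] [Algebra R K] [IsFractionRing R K]
    {Ω : Type*} [Field Ω] [Algebra K Ω] [Algebra R Ω] [IsScalarTower R K Ω]
    (L M : IntermediateField K Ω)
    (hL : LocalRamification.IsCyclicExtension K L (p ^ 2))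
    (hLr : LocalRamification.IsTotallyRamified R L)
    (hM : LocalRamification.IsCyclicExtension K M (p ^ 2))
    (hMr : LocalRamification.IsTotallyRamified R M)
    (hne : L ≠ M) (hld : ¬ L.LinearDisjoint M) :
    LocalRamification.IsCyclicExtension K ↥(L ⊓ M) p ∧
    Nonempty (Gal(↥(L ⊔ M)/K) ≃* Multiplicative (ZMod (p ^ 2) × ZMod p)) ∧
    (∀ (α β : TruncatedWittVector p 2 K) (a : TruncatedWittVector p 2 L)
        (b : TruncatedWittVector p 2 M),
        LocalRamification.IsASWGenerator α a → LocalRamification.IsASWGenerator β b →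
        L ⊓ M = IntermediateField.adjoin K {((a.coeff 0 : L) : Ω)} ∧
        L ⊓ M = IntermediateField.adjoin K {((b.coeff 0 : M) : Ω)}) ∧
    ∃ u₀ u₁ v₀ v₁ : ℝ, u₀ < u₁ ∧ v₀ < v₁ ∧
      LocalRamification.upperJumps R K L = {u₀, u₁} ∧
      LocalRamification.upperJumps R K M = {v₀, v₁} ∧
      u₀ = v₀ ∧
      LocalRamification.upperJumps R K ↥(L ⊓ M) = {u₀} ∧
      (u₁ ≠ v₁ → LocalRamification.upperJumps R K ↥(L ⊔ M) = {u₀, u₁, v₁}) ∧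
      (u₁ = v₁ → ∀ α β : TruncatedWittVector p 2 K,
        LocalRamification.CorrespondsTo L α → LocalRamification.CorrespondsTo M β →
        ∀ c : ZMod p, c ≠ 0 → α.coeff 0 = (c.cast : K) * β.coeff 0 →
        ¬ (p : ℤ) ∣ LocalRamification.ord R K (α.coeff 1 - (c.cast : K) * β.coeff 1) →
        -(LocalRamification.ord R K (α.coeff 1 - (c.cast : K) * β.coeff 1) : ℝ) ≠ u₀ →
        -(LocalRamification.ord R K (α.coeff 1 - (c.cast : K) * β.coeff 1) : ℝ) ≠ u₁ →
        LocalRamification.upperJumps R K ↥(L ⊔ M) =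
          {u₀, u₁, -(LocalRamification.ord R K (α.coeff 1 - (c.cast : K) * β.coeff 1) : ℝ)}) := by
  open LocalRamification in
  have hp : p.Prime := Fact.out
  have := hL.isGalois
  have := hM.isGalois
  have := hL.isCyclic
  have := hM.isCyclic
  have := hL.finiteDimensional (pow_pos hp.pos 2)
  have := hM.finiteDimensional (pow_pos hp.pos 2)
  have : IsAbelianGalois K L := .of_isCyclic K L
  have : IsAbelianGalois K M := .of_isCyclic K M
  have : IsAbelianGalois K ↥(L ⊔ M) := isAbelianGalois_sup
  have hN := isCyclicExtension_inf hL hM hne hld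
  have := hN.isGalois
  have hE : Module.finrank K ↥(L ⊔ M) = p ^ 3 := by
    rw [← IsGalois.card_aut_eq_finrank, card_aut_sup hL hM hne hld]
  have hLM : ¬ L ≤ M := fun h =>
    hne (IntermediateField.eq_of_le_of_finrank_eq h (hL.finrank_eq.trans hM.finrank_eq.symm))
  refine ⟨hN, nonempty_aut_sup_mulEquiv hL hM hne hld, fun α β a b ha hb =>
    ⟨inf_eq_adjoin_coeff_zero hL inf_le_left hN.finrank_eq ha,
      inf_eq_adjoin_coeff_zero hM inf_le_right hN.finrank_eq hb⟩, ?_⟩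
  obtain ⟨u₀, u₁, hu, hjL, hjN⟩ := exists_upperJumps_eq_pair_of_le (R := R)
    (inf_le_left : L ⊓ M ≤ L) hL.finrank_eq hN.finrank_eq
  obtain ⟨v₀, v₁, hv, hjM, hjN'⟩ := exists_upperJumps_eq_pair_of_le (R := R)
    (inf_le_right : L ⊓ M ≤ M) hM.finrank_eq hN.finrank_eq
  -- Both are the unique jump of `L ∩ M`, seen once inside `L` and once inside `M`.
  obtain rfl : u₀ = v₀ := Set.singleton_injective (hjN.symm.trans hjN')
  have hsL := upperJumps_subset_of_le (R := R) (le_sup_left : L ≤ L ⊔ M)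
  have hsM := upperJumps_subset_of_le (R := R) (le_sup_right : M ≤ L ⊔ M)
  rw [hjL] at hsL
  rw [hjM] at hsM
  have hu₀ := hsL (Set.mem_insert _ _)
  have hu₁ := hsL (Set.mem_insert_of_mem _ rfl)
  refine ⟨u₀, u₁, u₀, v₁, hu, hv, hjL, hjM, rfl, hjN, fun huv => ?_, ?_⟩
  · exact upperJumps_eq_triple R K _ hp hE hu.ne hv.ne huv hu₀ hu₁
      (hsM (Set.mem_insert_of_mem _ rfl))
  · rintro - α β ⟨a, ha⟩ ⟨b, hb⟩ c - h0 hpγ hγ₀ hγ₁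
    have hcp : (c.cast : K) ^ p = c.cast := by
      have h := congrArg (ZMod.castHom dvd_rfl K) (ZMod.pow_card c)
      rwa [map_pow] at h
    obtain ⟨y, hyE, hy, hyK⟩ := exists_artinSchreier_mem_sup ha hb hcp h0 hLM
    refine upperJumps_eq_triple R K _ hp hE hu.ne hγ₀.symm hγ₁.symm hu₀ hu₁
      (neg_ord_mem_upperJumps hE (y := ⟨y, hyE⟩) (Subtype.ext hy) (fun h => hyK ?_) hpγ)
    obtain ⟨z, hz⟩ := IntermediateField.mem_bot.1 h
    exact IntermediateField.mem_bot.2 ⟨z, congrArg Subtype.val hz⟩
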